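/- Let $M$ be a nonempty smooth manifold (Hausdorff, second countable, possibly with boundary) of dimension $m\ge 1$, let $k\ge 1$ and let $r\in\mathbb N$ be finite. Let $E^r=\mathcal C^r(M,\mathbb R^k)$ carry the weak Whitney topology (uniform convergence on compact subsets of charts of all derivatives of order at most $r$). A Borel probability measure $\mu$ on $E^r$ is called Gaussian if for all $p_1,\dots,p_j\in M$ the image of $\mu$ under $f\mapsto (f(p_1),\dots,f(p_j))\in\mathbb R^{jk}$ is a centered (possibly degenerate) Gaussian measure; let $\mathscr G(E^r)$ be the set of Gaussian measures on $E^r$ with the narrow topology. A $\mathcal C^r$ Gaussian random field (GRF) is a random element $X$ of $E^r$ whose law is in $\mathscr G(E^r)$. The covariance function of $\mu\in\mathscr G(E^r)$ is $K_\mu(p,q)=\int_{E^r} f(p)f(q)^T\,d\mu(f)$, and that of a GRF $X$ is $K_X(p,q)=\mathbb E\{X(p)X(q)^T\}$. Let $\mathcal C^{r,r}(M\times M,\mathbb R^{k\times k})$ be the space of functions with continuous partial derivatives of order at most $r$ in each of the two variables, with the topology of uniform convergence of all these mixed derivatives on compact subsets of products of charts. Then the inverse of the (injective) covariance map $\mathcal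 K^r:\mathscr G(E^r)\to\mathcal C^{r,r}(M\times M,\mathbb R^{k\times k})$, $\mu\mapsto K_\mu$, defined on the image of $\mathcal K^r$ with the subspace topology, is not continuous. Moreover, there is a sequence of $\mathcal C^r$ GRFs $X_n$ on $M$ with values in $\mathbb R^k$, defined on a common probability space, such that $K_{X_n}\to 0$ in $\mathcal C^{r,r}(M\times M,\mathbb R^{k\times k})$, but $X_n$ does not converge narrowly (in law, as random elements of $E^r$) to the zero field. -/

import Mathlib

open MeasureTheory ProbabilityTheory Filter Topology
open scoped Manifold ContDiff UniformConvergence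

noncomputable section

namespace GRF

variable {m : ℕ} {H : Type*} [TopologicalSpace H]

/-- The space `E^r = C^r(M, ℝᵏ)`, for `r` finite. -/
abbrev CrMap (I : ModelWithCorners ℝ (EuclideanSpace ℝ (Fin m)) H)
    (M : Type*) [TopologicalSpace M] [ChartedSpace H M] (k r : ℕ) :=
  C^(r : WithTop ℕ∞)⟮I, M; 𝓘(ℝ, EuclideanSpace ℝ (Fin k)), EuclideanSpace ℝ (Fin k)⟯

section Topology

variable (I : ModelWithCorners ℝ (EuclideanSpace ℝ (Fin m)) H)
  (M : Type*) [TopologicalSpace M] [ChartedSpace H M]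

/-- The weak Whitney topology on `C^r(M, ℝᵏ)`: uniform convergence of the derivatives of order
at most `r`, on every compact subset of the image of every smooth chart. -/
instance weakWhitneyTopology (k r : ℕ) : TopologicalSpace (CrMap I M k r) :=
  ⨅ (e : OpenPartialHomeomorph M H) (_ : e ∈ IsManifold.maximalAtlas I ∞ M)
    (i : ℕ) (_ : i ≤ r),
    TopologicalSpace.induced
      (fun f : CrMap I M k r =>
        UniformOnFun.ofFun {C | IsCompact C ∧ C ⊆ (e.extend I).target}
          (iteratedFDerivWithin ℝ i (f ∘ (e.extend I).symm) (e.extend I).target))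
      inferInstance

instance (k r : ℕ) : MeasurableSpace (CrMap I M k r) := borel _

instance (k r : ℕ) : BorelSpace (CrMap I M k r) := ⟨rfl⟩

end Topology

section Mixed

variable {E F : Type*} [NormedAddCommGroup E] [NormedSpace ℝ E]
  [NormedAddCommGroup F] [NormedSpace ℝ F]

/-- The mixed derivative `D₁ⁱ D₂ʲ G` of `G : S × T → F`: all partial derivatives of `G` that are
of order `i` in the first and of order `j` in the second variable. -/
def mixedDeriv (i j : ℕ) (S T : Set E) (G : E × E → F) (z : E × E) :
    E [×i]→L[ℝ] (E [×j]→L[ℝ] F) :=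
  iteratedFDerivWithin ℝ i (fun u => iteratedFDerivWithin ℝ j (fun v => G (u, v)) T z.2) S z.1

/-- `G` is of class `C^{r,r}` on `S × T`: the derivatives of order at most `r` in the second
variable, followed by those of order at most `r` in the first variable, exist and are jointly
continuous. -/
structure IsCrrOn (r : ℕ) (S T : Set E) (G : E × E → F) : Prop where
  snd : ∀ u ∈ S, ContDiffOn ℝ r (fun v => G (u, v)) T
  fst : ∀ j ≤ r, ∀ v ∈ T,
    ContDiffOn ℝ r (fun u => iteratedFDerivWithin ℝ j (fun v' => G (u, v')) T v) S
  cont : ∀ i ≤ r, ∀ j ≤ r, ContinuousOn (mixedDeriv i j S T G) (S ×ˢ T)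

theorem mixedDeriv_zero (i j : ℕ) (S T : Set E) :
    mixedDeriv i j S T (fun _ => (0 : F)) = 0 := by
  funext z
  have h : (fun _ : E => iteratedFDerivWithin ℝ j (fun _ : E => (0 : F)) T z.2) =
      fun _ => 0 := by
    funext u
    rw [iteratedFDerivWithin_fun_zero]
    rfl
  simp only [mixedDeriv]
  rw [h, iteratedFDerivWithin_fun_zero]
  rfl

theorem isCrrOn_zero (r : ℕ) (S T : Set E) : IsCrrOn r S T (fun _ : E × E => (0 : F)) where
  snd _ _ := contDiffOn_const
  fst j _ v _ := contDiffOn_const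
  cont i _ j _ := by
    rw [mixedDeriv_zero]
    exact continuousOn_const

end Mixed

section Crr

variable (I : ModelWithCorners ℝ (EuclideanSpace ℝ (Fin m)) H)
  (M : Type*) [TopologicalSpace M] [ChartedSpace H M]

/-- A function on `M × M`, read in a chart `e` for the first variable and a chart `e'` for the
second. -/
def inCharts {M : Type*} [TopologicalSpace M] {F : Type*} (e e' : OpenPartialHomeomorph M H)
    (K : M × M → F) (z : EuclideanSpace ℝ (Fin m) × EuclideanSpace ℝ (Fin m)) : F :=
  K ((e.extend I).symm z.1, (e'.extend I).symm z.2)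

/-- The space `C^{r,r}(M × M, ℝ^{k×k})` of the functions that have continuous partial derivatives
of order at most `r` with respect to both product variables. -/
def CrrMap (k r : ℕ) :=
  {K : M × M → Fin k → Fin k → ℝ //
    ∀ e ∈ IsManifold.maximalAtlas I ∞ M, ∀ e' ∈ IsManifold.maximalAtlas I ∞ M,
      IsCrrOn r (e.extend I).target (e'.extend I).target (inCharts I e e' K)}

instance (k r : ℕ) : CoeFun (CrrMap I M k r) (fun _ => M × M → Fin k → Fin k → ℝ) :=
  ⟨Subtype.val⟩

instance (k r : ℕ) : Zero (CrrMap I M k r) :=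
  ⟨⟨fun _ => 0, fun _ _ _ _ => isCrrOn_zero r _ _⟩⟩

/-- The topology of `C^{r,r}(M × M, ℝ^{k×k})`: uniform convergence of the mixed derivatives of
order at most `r` in each variable, on every compact subset of the image of every product of two
smooth charts. -/
instance (k r : ℕ) : TopologicalSpace (CrrMap I M k r) :=
  ⨅ (e : OpenPartialHomeomorph M H) (_ : e ∈ IsManifold.maximalAtlas I ∞ M)
    (e' : OpenPartialHomeomorph M H) (_ : e' ∈ IsManifold.maximalAtlas I ∞ M)
    (i : ℕ) (_ : i ≤ r) (j : ℕ) (_ : j ≤ r),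
    TopologicalSpace.induced
      (fun K : CrrMap I M k r =>
        UniformOnFun.ofFun {C | IsCompact C ∧ C ⊆ (e.extend I).target ×ˢ (e'.extend I).target}
          (mixedDeriv i j (e.extend I).target (e'.extend I).target (inCharts I e e' K.1)))
      inferInstance

end Crr

section Fields

variable {I : ModelWithCorners ℝ (EuclideanSpace ℝ (Fin m)) H}
  {M : Type*} [TopologicalSpace M] [ChartedSpace H M] {k r : ℕ}
  {Ω : Type*} [MeasurableSpace Ω]

/-- `X` is a (centered) `C^r` Gaussian random field on the probability space `(Ω, P)`: a random
element of `C^r(M, ℝᵏ)` such that `(X(p₁), …, X(p_j))` is a centered, possibly degenerate,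
Gaussian vector for all finite families of points of `M`. -/
structure IsGaussianField (P : Measure Ω) (X : Ω → CrMap I M k r) : Prop where
  measurable : Measurable X
  gaussian : ∀ (j : ℕ) (p : Fin j → M), IsGaussian (P.map (fun w i => X w (p i)))
  centered : ∀ p : M, ∫ w, X w p ∂P = 0

/-- The covariance function `(p, q) ↦ 𝔼[X(p) X(q)ᵀ]`. -/
def covarianceFun (P : Measure Ω) (X : Ω → CrMap I M k r) (z : M × M) : Fin k → Fin k → ℝ :=
  fun a b => ∫ w, X w z.1 a * X w z.2 b ∂P

variable (I M k r) in
/-- The space `𝒢(E^r)` of Gaussian measures on `E^r = C^r(M, ℝᵏ)`, with the topology induced by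
the narrow topology on the Borel probability measures on `E^r`. -/
abbrev GaussianMeasure :=
  {μ : ProbabilityMeasure (CrMap I M k r) // IsGaussianField (μ : Measure (CrMap I M k r)) id}

/-- The covariance function `(p, q) ↦ ∫ f(p) f(q)ᵀ dμ(f)` of a Gaussian measure. -/
def covarianceOf (μ : GaussianMeasure I M k r) : M × M → Fin k → Fin k → ℝ :=
  covarianceFun (μ.1 : Measure (CrMap I M k r)) id

variable (I M k r) in
/-- The image of the covariance map `μ ↦ K_μ` in `C^{r,r}(M × M, ℝ^{k×k})`, with the subspace
topology. -/
abbrev CovarianceImage :=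
  {K : CrrMap I M k r // ∃ μ : GaussianMeasure I M k r, covarianceOf μ = K.1}

end Fields

end GRF

end

/-!
Let `ψ ≠ 0` be a bump with support in an annulus `R / 2 < |x| < R`. Then the dilations
`f_l = 2^{-lr} ψ (2ˡ (x - y₀))`, read in one chart, have pairwise disjoint supports and are bounded
in `C^r`, and the factor `2^{-lr}` keeps their derivatives of order `r` at a fixed height.
Let `ξ_l` be independent standard Gaussian variables and put `X = v ∑_{l ∈ s} ξ_l f_l`. By
disjointness, the covariance `v vᵀ ∑_{l ∈ s} f_l(p) f_l(q)` is `O(|v|²)` in `C^{r,r}`, uniformly in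
`s`. The derivatives of order `r` of `X`, on the other hand, reach a multiple of
`|v| max_{l ∈ s} |ξ_l|`, which exceeds any given bound with probability at least `1/2` as soon as
`s` is large. Letting `v → 0` with `s` chosen accordingly, the covariances tend to `0` while the
fields stay away from `0` in law.

For an arbitrary right inverse of the covariance map, the Gaussian measure that it assigns to the
covariance of `X` has the same finite-dimensional distributions as `X`. The derivatives used above
are limits of difference quotients, hence functions of countably many evaluations, so they have the
same law under both measures.
-/

namespace GRF

/-! ### Dilations of a bump function -/

section Dilations

variable {E F : Type*} [NormedAddCommGroup E] [NormedSpace ℝ E]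
  [NormedAddCommGroup F] [NormedSpace ℝ F]

theorem exists_iteratedFDeriv_ne_zero [NoncompactSpace E] {ψ : E → F} (hψ : ContDiff ℝ ∞ ψ)
    (hs : HasCompactSupport ψ) (h0 : ψ ≠ 0) (r : ℕ) : ∃ z, iteratedFDeriv ℝ r ψ z ≠ 0 := by
  induction r with
  | zero =>
    obtain ⟨x, hx⟩ := Function.ne_iff.1 h0
    exact ⟨x, fun h => hx (by simpa using congrArg (· 0) h)⟩
  | succ r ih =>
    by_contra! h
    obtain ⟨z, hz⟩ := ih
    have hdiff : Differentiable ℝ (iteratedFDeriv ℝ r ψ) :=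
      hψ.differentiable_iteratedFDeriv (by exact_mod_cast WithTop.coe_lt_top r)
    have hfderiv : ∀ x, fderiv ℝ (iteratedFDeriv ℝ r ψ) x = 0 := fun x => by
      ext v w
      simpa [h x] using (iteratedFDeriv_succ_apply_left (𝕜 := ℝ) (f := ψ) (x := x)
        (Fin.cons v w)).symm
    obtain ⟨x, hx⟩ := (Set.ne_univ_iff_exists_notMem _).1 (hs.iteratedFDeriv (𝕜 := ℝ) r).ne_univ
    exact hz ((is_const_of_fderiv_eq_zero hdiff hfderiv z x).trans
      (image_eq_zero_of_notMem_tsupport hx))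

theorem exists_forall_norm_iteratedFDeriv_le {ψ : E → F} {r : ℕ} (hψ : ContDiff ℝ r ψ)
    (hs : HasCompactSupport ψ) : ∃ B, ∀ i ≤ r, ∀ x, ‖iteratedFDeriv ℝ i ψ x‖ ≤ B := by
  have h : ∀ i ≤ r, ∃ B, ∀ x, ‖iteratedFDeriv ℝ i ψ x‖ ≤ B := fun i hi =>
    (hψ.continuous_iteratedFDeriv (by exact_mod_cast hi)).bounded_above_of_compact_support
      (hs.iteratedFDeriv i)
  choose! B hB using h
  refine ⟨∑ i ∈ Finset.range (r + 1), B i, fun i hi x => (hB i hi x).trans ?_⟩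
  exact Finset.single_le_sum
    (fun j hj => (norm_nonneg _).trans (hB j (Nat.lt_succ_iff.1 (Finset.mem_range.1 hj)) 0))
    (Finset.mem_range.2 (Nat.lt_succ_of_le hi))

variable (E) in
theorem exists_bump_in_annulus [FiniteDimensional ℝ E] [Nontrivial E] {R : ℝ} (hR : 0 < R) :
    ∃ ψ : E → ℝ, ContDiff ℝ ∞ ψ ∧ HasCompactSupport ψ ∧ ψ ≠ 0 ∧
      tsupport ψ ⊆ {x | ‖x‖ ∈ Set.Ioo (R / 2) R} := by
  obtain ⟨v, hv⟩ := exists_norm_eq E (show 0 ≤ 3 / 4 * R by positivity)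
  have hmem : {x : E | ‖x‖ ∈ Set.Ioo (R / 2) R} ∈ 𝓝 v := by
    refine (isOpen_Ioo.preimage continuous_norm).mem_nhds ?_
    rw [Set.mem_preimage, hv]
    constructor <;> linarith
  obtain ⟨ψ, hψR, hs, hψ, -, hψv⟩ := exists_contDiff_tsupport_subset (n := ⊤) hmem
  exact ⟨ψ, hψ, hs, fun h => by simp [h] at hψv, hψR⟩

/-- The dilation `x ↦ 2^{-lr} ψ (2ˡ (x - y₀))`. The factor `2^{-lr}` preserves the size of the
derivatives of order `r` and does not increase that of the lower ones. -/
noncomputable def dilate (ψ : E → F) (r : ℕ) (y₀ : E) (l : ℕ) (x : E) : F :=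
  ((2 : ℝ) ^ (l * r))⁻¹ • ψ ((2 : ℝ) ^ l • (x - y₀))

section Dilate

variable {ψ : E → F} (r : ℕ) (y₀ : E) (l : ℕ)

theorem contDiff_dilate {n : WithTop ℕ∞} (hψ : ContDiff ℝ n ψ) :
    ContDiff ℝ n (dilate ψ r y₀ l) :=
  contDiff_const.smul (hψ.comp (contDiff_const.smul (contDiff_id.sub contDiff_const)))

theorem iteratedFDeriv_dilate {i : ℕ} (hψ : ContDiff ℝ i ψ) (x : E) :
    iteratedFDeriv ℝ i (dilate ψ r y₀ l) x =
      (((2 : ℝ) ^ (l * r))⁻¹ * 2 ^ (l * i)) • iteratedFDeriv ℝ i ψ ((2 : ℝ) ^ l • (x - y₀)) := by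
  have htrans : iteratedFDeriv ℝ i (fun x => ψ ((2 : ℝ) ^ l • (x - y₀))) x =
      iteratedFDeriv ℝ i (fun z => ψ ((2 : ℝ) ^ l • z)) (x - y₀) :=
    iteratedFDeriv_comp_sub (f := fun z => ψ ((2 : ℝ) ^ l • z)) i y₀ x
  have hsmooth : ContDiff ℝ i (fun x => ψ ((2 : ℝ) ^ l • (x - y₀))) :=
    hψ.comp (contDiff_const.smul (contDiff_id.sub contDiff_const))
  change iteratedFDeriv ℝ i (((2 : ℝ) ^ (l * r))⁻¹ • fun x => ψ ((2 : ℝ) ^ l • (x - y₀))) x = _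
  rw [iteratedFDeriv_const_smul_apply hsmooth.contDiffAt, htrans,
    iteratedFDeriv_comp_const_smul _ hψ, ← pow_mul, mul_smul]

theorem iteratedFDeriv_dilate_rescaled (hψ : ContDiff ℝ r ψ) (z : E) :
    iteratedFDeriv ℝ r (dilate ψ r y₀ l) (y₀ + ((2 : ℝ) ^ l)⁻¹ • z) = iteratedFDeriv ℝ r ψ z := by
  rw [iteratedFDeriv_dilate r y₀ l hψ, add_sub_cancel_left, smul_inv_smul₀ (by positivity),
    inv_mul_cancel₀ (by positivity), one_smul]

theorem norm_iteratedFDeriv_dilate_le {r i : ℕ} (hψ : ContDiff ℝ i ψ) (hi : i ≤ r) {B : ℝ}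
    (hB : ∀ x, ‖iteratedFDeriv ℝ i ψ x‖ ≤ B) (x : E) :
    ‖iteratedFDeriv ℝ i (dilate ψ r y₀ l) x‖ ≤ B := by
  have hscale : ((2 : ℝ) ^ (l * r))⁻¹ * 2 ^ (l * i) ≤ 1 := by
    rw [inv_mul_le_one₀ (by positivity)]
    exact pow_le_pow_right₀ one_le_two (Nat.mul_le_mul_left l hi)
  rw [iteratedFDeriv_dilate r y₀ l hψ, norm_smul, Real.norm_of_nonneg (by positivity)]
  exact (mul_le_of_le_one_left (norm_nonneg _) hscale).trans (hB _)

theorem tsupport_dilate_subset :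
    tsupport (dilate ψ r y₀ l) ⊆ (fun x => (2 : ℝ) ^ l • (x - y₀)) ⁻¹' tsupport ψ := by
  refine closure_minimal (fun x hx => subset_tsupport _ fun h => hx ?_)
    ((isClosed_tsupport ψ).preimage (by fun_prop))
  simp only [dilate, h, smul_zero]

variable {R : ℝ} (hψR : tsupport ψ ⊆ {x | ‖x‖ ∈ Set.Ioo (R / 2) R})

include hψR

theorem two_pow_mul_norm_sub_mem_Ioo {l : ℕ} {x : E} (hx : x ∈ tsupport (dilate ψ r y₀ l)) :
    2 ^ l * ‖x - y₀‖ ∈ Set.Ioo (R / 2) R := by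
  have h : ‖(2 : ℝ) ^ l • (x - y₀)‖ ∈ Set.Ioo (R / 2) R := hψR (tsupport_dilate_subset r y₀ l hx)
  rwa [norm_smul, Real.norm_of_nonneg (by positivity)] at h

theorem tsupport_dilate_subset_closedBall :
    tsupport (dilate ψ r y₀ l) ⊆ Metric.closedBall y₀ R := fun x hx => by
  rw [mem_closedBall_iff_norm]
  calc ‖x - y₀‖ ≤ 2 ^ l * ‖x - y₀‖ :=
        le_mul_of_one_le_left (norm_nonneg _) (one_le_pow₀ one_le_two)
    _ ≤ R := (two_pow_mul_norm_sub_mem_Ioo r y₀ hψR hx).2.le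

theorem pairwise_disjoint_tsupport_dilate :
    Pairwise (Function.onFun Disjoint fun l => tsupport (dilate ψ r y₀ l)) := by
  refine (pairwise_disjoint_on _).2 fun l l' hl => Set.disjoint_left.2 fun x hx hx' => ?_
  have hlow := (two_pow_mul_norm_sub_mem_Ioo r y₀ hψR hx).1
  have hupp := (two_pow_mul_norm_sub_mem_Ioo r y₀ hψR hx').2
  have hpow : (2 : ℝ) ^ l * 2 ≤ 2 ^ l' := by
    rw [← pow_succ]
    exact pow_le_pow_right₀ one_le_two hl
  nlinarith [mul_le_mul_of_nonneg_right hpow (norm_nonneg (x - y₀))]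

end Dilate

variable [FiniteDimensional ℝ E] [Nontrivial E]

theorem exists_disjoint_bumps (y₀ : E) {R : ℝ} (hR : 0 < R) (r : ℕ) :
    ∃ g : ℕ → E → ℝ, (∀ l, ContDiff ℝ ∞ (g l)) ∧ (∀ l, tsupport (g l) ⊆ Metric.closedBall y₀ R) ∧
      Pairwise (Function.onFun Disjoint fun l => tsupport (g l)) ∧
      (∃ B, ∀ l, ∀ i ≤ r, ∀ x, ‖iteratedFDeriv ℝ i (g l) x‖ ≤ B) ∧
      ∃ (z : ℕ → E) (v : Fin r → E) (c : ℝ), c ≠ 0 ∧ (∀ l, z l ∈ Metric.closedBall y₀ R) ∧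
        ∀ l, iteratedFDeriv ℝ r (g l) (z l) v = c := by
  obtain ⟨ψ, hψ, hs, hψ0, hψR⟩ := exists_bump_in_annulus E hR
  have hψr : ContDiff ℝ r ψ := hψ.of_le (by exact_mod_cast le_top)
  obtain ⟨z, hz⟩ := exists_iteratedFDeriv_ne_zero hψ hs hψ0 r
  obtain ⟨v, hv⟩ : ∃ v, iteratedFDeriv ℝ r ψ z v ≠ 0 := by
    contrapose! hz
    exact ContinuousMultilinearMap.ext hz
  obtain ⟨B, hB⟩ := exists_forall_norm_iteratedFDeriv_le hψr hs
  have hgz : ∀ l, iteratedFDeriv ℝ r (dilate ψ r y₀ l) (y₀ + ((2 : ℝ) ^ l)⁻¹ • z) =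
    iteratedFDeriv ℝ r ψ z := fun l => iteratedFDeriv_dilate_rescaled r y₀ l hψr z
  have hgR := fun l => tsupport_dilate_subset_closedBall r y₀ l hψR
  refine ⟨dilate ψ r y₀, fun l => contDiff_dilate r y₀ l hψ, hgR,
    pairwise_disjoint_tsupport_dilate r y₀ hψR, ⟨B, fun l i hi => ?_⟩,
    fun l => y₀ + ((2 : ℝ) ^ l)⁻¹ • z, v, _, hv, fun l => hgR l ?_, fun l => by rw [hgz l]⟩
  · exact norm_iteratedFDeriv_dilate_le y₀ l (hψr.of_le (by exact_mod_cast hi)) hi (hB i hi)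
  · exact support_iteratedFDeriv_subset (𝕜 := ℝ) r (Function.mem_support.2 (hgz l ▸ hz))

end Dilations

/-! ### Derivatives in charts -/

section ExtendByZero

variable {m : ℕ} {H : Type*} [TopologicalSpace H]
  {I : ModelWithCorners ℝ (EuclideanSpace ℝ (Fin m)) H}
  {M : Type*} [TopologicalSpace M] {V : Type*} [Zero V]

variable (I) in
/-- The extension by zero to `M` of a function `g` read in the chart `e`. -/
noncomputable def extendByZero (e : OpenPartialHomeomorph M H)
    (g : EuclideanSpace ℝ (Fin m) → V) : M → V :=
  e.source.indicator (g ∘ e.extend I)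

variable (e : OpenPartialHomeomorph M H)

theorem isCompact_extend_symm_image {Z : Set (EuclideanSpace ℝ (Fin m))} (hZ : IsCompact Z)
    (hZt : Z ⊆ (e.extend I).target) : IsCompact ((e.extend I).symm '' Z) :=
  hZ.image_of_continuousOn (e.continuousOn_extend_symm.mono hZt)

variable [T2Space M]

theorem tsupport_extendByZero_subset {g : EuclideanSpace ℝ (Fin m) → V} (hg : HasCompactSupport g)
    (hgt : tsupport g ⊆ (e.extend I).target) :
    tsupport (extendByZero I e g) ⊆ (e.extend I).symm '' tsupport g := by
  refine closure_minimal (fun p hp => ?_) (isCompact_extend_symm_image e hg hgt).isClosed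
  have hps : p ∈ e.source := Set.mem_of_indicator_ne_zero hp
  rw [Function.mem_support, extendByZero, Set.indicator_of_mem hps] at hp
  exact ⟨_, subset_tsupport g hp, e.extend_left_inv hps⟩

theorem disjoint_tsupport_extendByZero {g g' : EuclideanSpace ℝ (Fin m) → V}
    (hg : HasCompactSupport g) (hgt : tsupport g ⊆ (e.extend I).target)
    (hg' : HasCompactSupport g') (hgt' : tsupport g' ⊆ (e.extend I).target)
    (h : Disjoint (tsupport g) (tsupport g')) :
    Disjoint (tsupport (extendByZero I e g)) (tsupport (extendByZero I e g')) := by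
  refine Set.disjoint_of_subset (tsupport_extendByZero_subset e hg hgt)
    (tsupport_extendByZero_subset e hg' hgt') (Set.disjoint_left.2 ?_)
  rintro _ ⟨y, hy, rfl⟩ ⟨y', hy', hyy'⟩
  exact Set.disjoint_left.1 h hy ((e.extend I).symm.injOn (hgt' hy') (hgt hy) hyy' ▸ hy')

end ExtendByZero

section Charts

variable {m : ℕ} {H : Type*} [TopologicalSpace H]
  {I : ModelWithCorners ℝ (EuclideanSpace ℝ (Fin m)) H}
  {M : Type*} [TopologicalSpace M] {V : Type*} [NormedAddCommGroup V] [NormedSpace ℝ V]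

variable (I) in
/-- The derivative of order `i` of `f`, read in the chart `e`. -/
noncomputable def chartDeriv (e : OpenPartialHomeomorph M H) (i : ℕ) (f : M → V) :
    EuclideanSpace ℝ (Fin m) → EuclideanSpace ℝ (Fin m) [×i]→L[ℝ] V :=
  iteratedFDerivWithin ℝ i (f ∘ (e.extend I).symm) (e.extend I).target

variable (e : OpenPartialHomeomorph M H)

theorem uniqueDiffOn_extend_target : UniqueDiffOn ℝ (e.extend I).target := by
  rw [e.extend_target]
  exact I.uniqueDiffOn_preimage e.open_target

theorem extend_symm_mem_source {x : EuclideanSpace ℝ (Fin m)} (hx : x ∈ (e.extend I).target) :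
    (e.extend I).symm x ∈ e.source := by
  simpa only [e.extend_source] using (e.extend I).map_target hx

theorem nonempty_interior_extend_target {p : M} (hp : p ∈ e.source) :
    (interior (e.extend I).target).Nonempty := by
  have hopen : IsOpen (I.symm ⁻¹' e.target) := e.open_target.preimage I.continuous_symm
  have hmem : I (e p) ∈ I.symm ⁻¹' e.target := by
    rw [Set.mem_preimage, I.left_inv]
    exact e.map_source hp
  obtain ⟨y, hy⟩ := mem_closure_iff.1
    (I.range_subset_closure_interior (Set.mem_range_self (e p))) _ hopen hmem
  refine ⟨y, mem_interior.2 ⟨_, ?_, hopen.inter isOpen_interior, hy⟩⟩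
  rw [e.extend_target]
  exact Set.inter_subset_inter_right _ interior_subset

theorem chartDeriv_eq_zero_of_notMem_tsupport {f : M → V} {x : EuclideanSpace ℝ (Fin m)}
    (hx : x ∈ (e.extend I).target) (hxf : (e.extend I).symm x ∉ tsupport f) (i : ℕ) :
    chartDeriv I e i f x = 0 := by
  have h : f ∘ (e.extend I).symm =ᶠ[𝓝[(e.extend I).target] x] fun _ => 0 := by
    filter_upwards [(e.continuousOn_extend_symm (I := I) x hx).preimage_mem_nhdsWithin
      ((isClosed_tsupport f).isOpen_compl.mem_nhds hxf)] with y hy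
      using image_eq_zero_of_notMem_tsupport (f := f) hy
  rw [chartDeriv, h.iteratedFDerivWithin_eq (h.eq_of_nhdsWithin hx), iteratedFDerivWithin_fun_zero]
  rfl

theorem chartDeriv_extendByZero_of_mem_interior (g : EuclideanSpace ℝ (Fin m) → V)
    {x : EuclideanSpace ℝ (Fin m)} (hx : x ∈ interior (e.extend I).target) (i : ℕ) :
    chartDeriv I e i (extendByZero I e g) x = iteratedFDeriv ℝ i g x := by
  have hEq : Set.EqOn (extendByZero I e g ∘ (e.extend I).symm) g (e.extend I).target :=
    fun y hy => by
      rw [Function.comp_apply, extendByZero, Set.indicator_of_mem (extend_symm_mem_source e hy),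
        Function.comp_apply, (e.extend I).right_inv hy]
  rw [chartDeriv, iteratedFDerivWithin_congr hEq (interior_subset hx), ← iteratedFDerivWithin_univ]
  exact iteratedFDerivWithin_congr_set (eventuallyEq_univ.2 (mem_interior_iff_mem_nhds.1 hx)) i

theorem source_extendCoordChange_eq (e' : OpenPartialHomeomorph M H) :
    (I.extendCoordChange e e').source =
      (e.extend I).target ∩ (e.extend I).symm ⁻¹' e'.source := by
  simp only [PartialEquiv.trans_source, PartialEquiv.symm_source, e'.extend_source]

theorem chartDeriv_extendByZero_of_mem_source (e' : OpenPartialHomeomorph M H)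
    (g : EuclideanSpace ℝ (Fin m) → V) {x : EuclideanSpace ℝ (Fin m)}
    (hx : x ∈ (I.extendCoordChange e' e).source) (i : ℕ) :
    chartDeriv I e' i (extendByZero I e g) x =
      iteratedFDerivWithin ℝ i (g ∘ I.extendCoordChange e' e)
        (I.extendCoordChange e' e).source x := by
  have hx' := hx
  rw [source_extendCoordChange_eq] at hx'
  have hnhds : (e'.extend I).symm ⁻¹' e.source ∈ 𝓝[(e'.extend I).target] x :=
    (e'.continuousOn_extend_symm (I := I) x hx'.1).preimage_mem_nhdsWithin
      (e.open_source.mem_nhds hx'.2)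
  rw [chartDeriv, ← iteratedFDerivWithin_inter' hnhds, ← source_extendCoordChange_eq]
  refine iteratedFDerivWithin_congr (fun y hy => ?_) hx i
  rw [source_extendCoordChange_eq] at hy
  exact Set.indicator_of_mem (show (e'.extend I).symm y ∈ e.source from hy.2) _

end Charts

section CrBounds

variable {E F V : Type*} [NormedAddCommGroup E] [NormedSpace ℝ E]
  [NormedAddCommGroup F] [NormedSpace ℝ F] [NormedAddCommGroup V] [NormedSpace ℝ V]

theorem exists_norm_iteratedFDerivWithin_comp_le {φ : E → F} {r : ℕ} {S C : Set E}
    (hφ : ContDiffOn ℝ r φ S) (hS : UniqueDiffOn ℝ S) (hC : IsCompact C) (hCS : C ⊆ S) (B : ℝ) :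
    ∃ A, ∀ g : F → V, ContDiff ℝ r g → (∀ i ≤ r, ∀ x, ‖iteratedFDeriv ℝ i g x‖ ≤ B) →
      ∀ i ≤ r, ∀ x ∈ C, ‖iteratedFDerivWithin ℝ i (g ∘ φ) S x‖ ≤ A := by
  have hD : ∀ i ≤ r, ∃ D, ∀ x ∈ C, ‖iteratedFDerivWithin ℝ i φ S x‖ ≤ D := fun i hi =>
    hC.exists_bound_of_continuousOn
      ((hφ.continuousOn_iteratedFDerivWithin (by exact_mod_cast hi) hS).mono hCS)
  choose! D hD using hD
  set A := 1 + ∑ i ∈ Finset.range (r + 1), |D i|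
  have hA : 1 ≤ A := le_add_of_nonneg_right (Finset.sum_nonneg fun _ _ => abs_nonneg _)
  have hDA : ∀ i ≤ r, D i ≤ A := fun i hi => (le_abs_self _).trans <|
    (Finset.single_le_sum (f := fun i => |D i|) (fun _ _ => abs_nonneg _)
      (Finset.mem_range.2 (Nat.lt_succ_of_le hi))).trans (le_add_of_nonneg_left zero_le_one)
  refine ⟨r.factorial * B * A ^ r, fun g hg hB i hi x hx => ?_⟩
  have hB0 : 0 ≤ B := (norm_nonneg _).trans (hB 0 (Nat.zero_le r) 0)
  calc ‖iteratedFDerivWithin ℝ i (g ∘ φ) S x‖ ≤ i.factorial * B * A ^ i :=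
        norm_iteratedFDerivWithin_comp_le hg.contDiffOn hφ (by exact_mod_cast hi)
          uniqueDiffOn_univ hS (Set.mapsTo_univ _ _) (hCS hx)
          (fun j hj => by simpa only [iteratedFDerivWithin_univ] using hB j (hj.trans hi) _)
          fun j hj hji => (hD j (hji.trans hi) x hx).trans <|
            (hDA j (hji.trans hi)).trans (le_self_pow₀ hA (Nat.one_le_iff_ne_zero.1 hj))
    _ ≤ r.factorial * B * A ^ r := by gcongr

variable {m : ℕ} {H : Type*} [TopologicalSpace H]
  {I : ModelWithCorners ℝ (EuclideanSpace ℝ (Fin m)) H}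
  {M : Type*} [TopologicalSpace M] [ChartedSpace H M]

variable (I) in
/-- A family of functions on `M` is bounded in `C^r` if on every compact subset of every smooth
chart its derivatives of order at most `r` are uniformly bounded. -/
def IsCrBounded {ι : Type*} (r : ℕ) (f : ι → M → V) : Prop :=
  ∀ e ∈ IsManifold.maximalAtlas I ∞ M, ∀ C, IsCompact C → C ⊆ (e.extend I).target →
    ∃ B, ∀ i ≤ r, ∀ l, ∀ x ∈ C, ‖chartDeriv I e i (f l) x‖ ≤ B

theorem contDiffOn_comp_extend_symm {e : OpenPartialHomeomorph M H}
    (he : e ∈ IsManifold.maximalAtlas I ∞ M) {n : WithTop ℕ∞} (hn : n ≤ ∞) {f : M → V}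
    (hf : ContMDiff I 𝓘(ℝ, V) n f) :
    ContDiffOn ℝ n (f ∘ (e.extend I).symm) (e.extend I).target := by
  rw [← contMDiffOn_iff_contDiffOn, e.extend_target']
  exact hf.comp_contMDiffOn ((contMDiffOn_extend_symm he).of_le hn)

variable [T2Space M] {e : OpenPartialHomeomorph M H} (he : e ∈ IsManifold.maximalAtlas I ∞ M)

include he

theorem contMDiff_extendByZero {n : WithTop ℕ∞} (hn : n ≤ ∞) {g : EuclideanSpace ℝ (Fin m) → V}
    (hg : ContDiff ℝ n g) (hs : HasCompactSupport g) (hgt : tsupport g ⊆ (e.extend I).target) :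
    ContMDiff I 𝓘(ℝ, V) n (extendByZero I e g) := by
  refine contMDiff_of_tsupport fun p hp => ?_
  obtain ⟨y, hy, rfl⟩ := tsupport_extendByZero_subset e hs hgt hp
  have hmem := extend_symm_mem_source e (hgt hy)
  have hchart := I.contMDiff.contMDiffAt.comp _ ((contMDiffAt_of_mem_maximalAtlas he hmem).of_le hn)
  refine (hg.contMDiff.contMDiffAt.comp _ hchart).congr_of_eventuallyEq ?_
  filter_upwards [e.open_source.mem_nhds hmem] with q hq
  rw [extendByZero, Set.indicator_of_mem hq]
  rfl

theorem isCrBounded_extendByZero {ι : Type*} {r : ℕ} {g : ι → EuclideanSpace ℝ (Fin m) → V}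
    {Z : Set (EuclideanSpace ℝ (Fin m))} (hZ : IsCompact Z) (hZt : Z ⊆ (e.extend I).target)
    (hg : ∀ l, ContDiff ℝ r (g l)) (hgZ : ∀ l, tsupport (g l) ⊆ Z) {B : ℝ}
    (hB : ∀ l, ∀ i ≤ r, ∀ x, ‖iteratedFDeriv ℝ i (g l) x‖ ≤ B) :
    IsCrBounded I r fun l => extendByZero I e (g l) := by
  intro e' he' C hC hCt
  have hs : ∀ l, HasCompactSupport (g l) := fun l =>
    hZ.of_isClosed_subset (isClosed_tsupport _) (hgZ l)
  set Q := (e.extend I).symm '' Z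
  have hCQ : IsCompact (C ∩ (e'.extend I).symm ⁻¹' Q) := hC.of_isClosed_subset
    ((e'.continuousOn_extend_symm.mono hCt).preimage_isClosed_of_isClosed hC.isClosed
      (isCompact_extend_symm_image e hZ hZt).isClosed) Set.inter_subset_left
  have hCQs : C ∩ (e'.extend I).symm ⁻¹' Q ⊆ (I.extendCoordChange e' e).source := by
    rintro x ⟨hxC, y, hy, hyx⟩
    rw [source_extendCoordChange_eq]
    exact ⟨hCt hxC, by simpa only [Set.mem_preimage, ← hyx] using extend_symm_mem_source e (hZt hy)⟩
  obtain ⟨A, hA⟩ := exists_norm_iteratedFDerivWithin_comp_le (V := V) (r := r)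
    ((I.contDiffOn_extendCoordChange he' he).of_le (by exact_mod_cast le_top))
    I.uniqueDiffOn_extendCoordChange_source hCQ hCQs B
  refine ⟨max A 0, fun i hi l x hx => ?_⟩
  by_cases hxQ : (e'.extend I).symm x ∈ Q
  · rw [chartDeriv_extendByZero_of_mem_source e e' _ (hCQs ⟨hx, hxQ⟩)]
    exact (hA (g l) (hg l) (hB l) i hi x ⟨hx, hxQ⟩).trans (le_max_left _ _)
  · rw [chartDeriv_eq_zero_of_notMem_tsupport e' (hCt hx) fun hmem => hxQ ?_, norm_zero]
    · exact le_max_right _ _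
    · exact Set.image_mono (hgZ l)
        (tsupport_extendByZero_subset e (hs l) ((hgZ l).trans hZt) hmem)

end CrBounds

section BumpSequence

variable {m : ℕ} {H : Type*} [TopologicalSpace H]
  (I : ModelWithCorners ℝ (EuclideanSpace ℝ (Fin m)) H)
  (M : Type*) [TopologicalSpace M] [ChartedSpace H M]

/-- A sequence of directional derivatives of order `r`: in the chart `chart`, at the points
`point l` of the compact set `compact`, and in the directions `vec`. -/
structure JetProbe (r : ℕ) where
  chart : OpenPartialHomeomorph M H
  chart_mem : chart ∈ IsManifold.maximalAtlas I ∞ M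
  compact : Set (EuclideanSpace ℝ (Fin m))
  isCompact : IsCompact compact
  subset_interior : compact ⊆ interior (chart.extend I).target
  point : ℕ → EuclideanSpace ℝ (Fin m)
  point_mem : ∀ l, point l ∈ compact
  vec : Fin r → EuclideanSpace ℝ (Fin m)

/-- A sequence of functions that is bounded in `C^r` and has disjoint supports, although its
`l`-th member has the derivative `height ≠ 0` of order `r` at the point `point l`. -/
structure BumpSequence (r : ℕ) extends JetProbe I M r where
  toFun : ℕ → M → ℝ
  contMDiff : ∀ l, ContMDiff I 𝓘(ℝ) ∞ (toFun l)
  isCrBounded : IsCrBounded I r toFun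
  disjoint : Pairwise (Function.onFun Disjoint fun l => tsupport (toFun l))
  height : ℝ
  height_ne_zero : height ≠ 0
  chartDeriv_point : ∀ l, chartDeriv I chart r (toFun l) (point l) vec = height

theorem exists_bumpSequence [IsManifold I ∞ M] [T2Space M] [Nonempty M] (hm : 0 < m) (r : ℕ) :
    Nonempty (BumpSequence I M r) := by
  have : Nonempty (Fin m) := ⟨⟨0, hm⟩⟩
  obtain ⟨p⟩ := ‹Nonempty M›
  set e := chartAt H p
  have he : e ∈ IsManifold.maximalAtlas I ∞ M := IsManifold.chart_mem_maximalAtlas p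
  obtain ⟨y₀, hy₀⟩ := nonempty_interior_extend_target (I := I) e (mem_chart_source H p)
  obtain ⟨R, hR, hball⟩ := Metric.nhds_basis_closedBall.mem_iff.1 (isOpen_interior.mem_nhds hy₀)
  obtain ⟨g, hg, hgZ, hdisj, ⟨B, hB⟩, z, v, c, hc, hzZ, hgz⟩ := exists_disjoint_bumps y₀ hR r
  set Z := Metric.closedBall y₀ R
  have hZ : IsCompact Z := isCompact_closedBall y₀ R
  have hgt : ∀ l, tsupport (g l) ⊆ (e.extend I).target := fun l =>
    (hgZ l).trans (hball.trans interior_subset)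
  have hgs : ∀ l, HasCompactSupport (g l) := fun l =>
    hZ.of_isClosed_subset (isClosed_tsupport _) (hgZ l)
  exact ⟨{
    chart := e
    chart_mem := he
    compact := Z
    isCompact := hZ
    subset_interior := hball
    point := z
    point_mem := hzZ
    vec := v
    toFun := fun l => extendByZero I e (g l)
    contMDiff := fun l => contMDiff_extendByZero he le_rfl (hg l) (hgs l) (hgt l)
    isCrBounded := isCrBounded_extendByZero he hZ (hball.trans interior_subset)
      (fun l => (hg l).of_le (by exact_mod_cast le_top)) hgZ hB
    disjoint := fun l l' hl =>
      disjoint_tsupport_extendByZero e (hgs l) (hgt l) (hgs l') (hgt l') (hdisj hl)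
    height := c
    height_ne_zero := hc
    chartDeriv_point := fun l => by
      rw [chartDeriv_extendByZero_of_mem_interior e _ (hball (hzZ l)), hgz] }⟩

namespace BumpSequence

variable {I M} {r : ℕ} (b : BumpSequence I M r)

theorem contDiffOn {e : OpenPartialHomeomorph M H} (he : e ∈ IsManifold.maximalAtlas I ∞ M)
    (l i : ℕ) : ContDiffOn ℝ i (b.toFun l ∘ (e.extend I).symm) (e.extend I).target :=
  (contDiffOn_comp_extend_symm he le_rfl (b.contMDiff l)).of_le (by exact_mod_cast le_top)

theorem chartDeriv_eq_zero_or (e : OpenPartialHomeomorph M H) {x : EuclideanSpace ℝ (Fin m)}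
    (hx : x ∈ (e.extend I).target) (i : ℕ) {l l' : ℕ} (hl : l ≠ l') :
    chartDeriv I e i (b.toFun l) x = 0 ∨ chartDeriv I e i (b.toFun l') x = 0 := by
  by_cases h : (e.extend I).symm x ∈ tsupport (b.toFun l)
  · exact .inr <| chartDeriv_eq_zero_of_notMem_tsupport e hx
      (Set.disjoint_left.1 (b.disjoint hl) h) i
  · exact .inl <| chartDeriv_eq_zero_of_notMem_tsupport e hx h i

theorem chartDeriv_point_of_ne {l l' : ℕ} (hl : l' ≠ l) :
    chartDeriv I b.chart r (b.toFun l') (b.point l) = 0 := by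
  refine (b.chartDeriv_eq_zero_or b.chart (interior_subset (b.subset_interior (b.point_mem l)))
    r hl).resolve_right fun h => b.height_ne_zero ?_
  rw [← b.chartDeriv_point l, h, zero_apply]

end BumpSequence

end BumpSequence

/-! ### Sums of products -/

section Sums

variable {ι W : Type*} [NormedAddCommGroup W]

theorem norm_sum_le_of_pairwise_eq_zero {x : ι → W} (hx : Pairwise fun l l' => x l = 0 ∨ x l' = 0)
    {B : ℝ} (hB0 : 0 ≤ B) (hB : ∀ l, ‖x l‖ ≤ B) (s : Finset ι) : ‖∑ l ∈ s, x l‖ ≤ B := by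
  by_cases h : ∃ l ∈ s, x l ≠ 0
  · obtain ⟨l, hl, hxl⟩ := h
    rw [Finset.sum_eq_single_of_mem l hl fun l' _ hl' => (hx hl').resolve_right hxl]
    exact hB l
  · push Not at h
    rwa [Finset.sum_eq_zero h, norm_zero]

variable {E : Type*} [NormedAddCommGroup E] [NormedSpace ℝ E] [NormedSpace ℝ W]

theorem iteratedFDerivWithin_smul_const_eq_smulRight {g : E → ℝ} {S : Set E}
    (hS : UniqueDiffOn ℝ S) {i : ℕ} (hg : ContDiffOn ℝ i g S) {x : E} (hx : x ∈ S) (y : W) :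
    iteratedFDerivWithin ℝ i (fun u => g u • y) S x =
      (iteratedFDerivWithin ℝ i g S x).smulRight y := by
  rw [iteratedFDerivWithin_smul_const_apply (hg x hx) hS hx]
  ext v
  simp

theorem iteratedFDerivWithin_sum_smul {g : ι → E → ℝ} {S : Set E} (hS : UniqueDiffOn ℝ S) {i : ℕ}
    (hg : ∀ l, ContDiffOn ℝ i (g l) S) {x : E} (hx : x ∈ S) (y : ι → W) (s : Finset ι) :
    iteratedFDerivWithin ℝ i (fun u => ∑ l ∈ s, g l u • y l) S x =
      ∑ l ∈ s, (iteratedFDerivWithin ℝ i (g l) S x).smulRight (y l) := by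
  rw [iteratedFDerivWithin_fun_sum_apply (f := fun l u => g l u • y l) hS hx
    fun l _ => (hg l x hx).smul_const (y l)]
  exact Finset.sum_congr rfl fun l _ =>
    iteratedFDerivWithin_smul_const_eq_smulRight hS (hg l) hx (y l)

theorem iteratedFDerivWithin_sum_const_smul {h : ι → E → W} {T : Set E} (hT : UniqueDiffOn ℝ T)
    {j : ℕ} (hh : ∀ l, ContDiffOn ℝ j (h l) T) {x : E} (hx : x ∈ T) (c : ι → ℝ) (s : Finset ι) :
    iteratedFDerivWithin ℝ j (fun v => ∑ l ∈ s, c l • h l v) T x =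
      ∑ l ∈ s, c l • iteratedFDerivWithin ℝ j (h l) T x := by
  rw [iteratedFDerivWithin_fun_sum_apply (f := fun l v => c l • h l v) hT hx
    fun l _ => (hh l x hx).const_smul (c l)]
  exact Finset.sum_congr rfl fun l _ =>
    iteratedFDerivWithin_const_smul_apply (hh l x hx) hT hx

variable {g : ι → E → ℝ} {h : ι → E → W} {S T : Set E} (s : Finset ι)

theorem mixedDeriv_sum_smul (hS : UniqueDiffOn ℝ S) (hT : UniqueDiffOn ℝ T) {i j : ℕ}
    (hg : ∀ l, ContDiffOn ℝ i (g l) S) (hh : ∀ l, ContDiffOn ℝ j (h l) T)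
    {z : E × E} (hz : z ∈ S ×ˢ T) :
    mixedDeriv i j S T (fun z => ∑ l ∈ s, g l z.1 • h l z.2) z =
      ∑ l ∈ s, (iteratedFDerivWithin ℝ i (g l) S z.1).smulRight
        (iteratedFDerivWithin ℝ j (h l) T z.2) := by
  rw [mixedDeriv, ← iteratedFDerivWithin_sum_smul hS hg hz.1]
  congr 1
  exact funext fun u => iteratedFDerivWithin_sum_const_smul hT hh hz.2 (fun l => g l u) s

theorem isCrrOn_sum_smul {r : ℕ} (hS : UniqueDiffOn ℝ S) (hT : UniqueDiffOn ℝ T)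
    (hg : ∀ l, ContDiffOn ℝ r (g l) S) (hh : ∀ l, ContDiffOn ℝ r (h l) T) :
    IsCrrOn r S T (fun z => ∑ l ∈ s, g l z.1 • h l z.2) where
  snd u _ := ContDiffOn.sum fun l _ => (hh l).const_smul (g l u)
  fst j hj v hv := by
    refine (ContDiffOn.sum (s := s) fun l _ =>
      (hg l).smul_const (iteratedFDerivWithin ℝ j (h l) T v)).congr fun u _ => ?_
    exact iteratedFDerivWithin_sum_const_smul hT (fun l => (hh l).of_le (by exact_mod_cast hj)) hv
      (fun l => g l u) s
  cont i hi j hj := by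
    have hi' : (i : WithTop ℕ∞) ≤ r := by exact_mod_cast hi
    have hj' : (j : WithTop ℕ∞) ≤ r := by exact_mod_cast hj
    refine ContinuousOn.congr (continuousOn_finsetSum s fun l _ => ?_) fun z hz =>
      mixedDeriv_sum_smul s hS hT (fun l => (hg l).of_le hi') (fun l => (hh l).of_le hj') hz
    have hfst : ContinuousOn (fun z : E × E => iteratedFDerivWithin ℝ i (g l) S z.1) (S ×ˢ T) :=
      ((hg l).continuousOn_iteratedFDerivWithin hi' hS).comp continuousOn_fst fun z hz => hz.1
    have hsnd : ContinuousOn (fun z : E × E => iteratedFDerivWithin ℝ j (h l) T z.2) (S ×ˢ T) :=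
      ((hh l).continuousOn_iteratedFDerivWithin hj' hT).comp continuousOn_snd fun z hz => hz.2
    exact ((ContinuousMultilinearMap.smulRightL ℝ (fun _ : Fin i => E)
      (E [×j]→L[ℝ] W)).continuous.comp_continuousOn hfst).clm_apply hsnd

theorem norm_mixedDeriv_sum_smul_le (hS : UniqueDiffOn ℝ S) (hT : UniqueDiffOn ℝ T) {i j : ℕ}
    (hg : ∀ l, ContDiffOn ℝ i (g l) S) (hh : ∀ l, ContDiffOn ℝ j (h l) T)
    {z : E × E} (hz : z ∈ S ×ˢ T) {B B' : ℝ} (hB0 : 0 ≤ B) (hB0' : 0 ≤ B')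
    (hB : ∀ l, ‖iteratedFDerivWithin ℝ i (g l) S z.1‖ ≤ B)
    (hB' : ∀ l, ‖iteratedFDerivWithin ℝ j (h l) T z.2‖ ≤ B')
    (hdisj : Pairwise fun l l' => iteratedFDerivWithin ℝ i (g l) S z.1 = 0 ∨
      iteratedFDerivWithin ℝ i (g l') S z.1 = 0) :
    ‖mixedDeriv i j S T (fun z => ∑ l ∈ s, g l z.1 • h l z.2) z‖ ≤ B * B' := by
  rw [mixedDeriv_sum_smul s hS hT hg hh hz]
  have hzero : ∀ l, iteratedFDerivWithin ℝ i (g l) S z.1 = 0 →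
      (iteratedFDerivWithin ℝ i (g l) S z.1).smulRight (iteratedFDerivWithin ℝ j (h l) T z.2) = 0 :=
    fun l hl => by
      rw [hl]
      ext
      simp
  refine norm_sum_le_of_pairwise_eq_zero (W := E [×i]→L[ℝ] E [×j]→L[ℝ] W)
    (fun l l' hl => (hdisj hl).imp (hzero l) (hzero l')) (mul_nonneg hB0 hB0') (fun l => ?_) s
  rw [ContinuousMultilinearMap.norm_smulRight]
  exact mul_le_mul (hB l) (hB' l) (norm_nonneg _) hB0

end Sums

/-! ### Convergence in `C^r` and `C^{r,r}` -/

theorem tendstoUniformlyOn_zero_of_norm_le {α β W : Type*} [NormedAddCommGroup W] {u : Filter α}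
    {G : α → β → W} {C : Set β} {a : α → ℝ} (ha : Tendsto a u (𝓝 0))
    (hG : ∀ n, ∀ z ∈ C, ‖G n z‖ ≤ a n) : TendstoUniformlyOn G 0 u C := by
  rw [Metric.tendstoUniformlyOn_iff]
  intro ε hε
  filter_upwards [ha.eventually_lt_const hε] with n hn z hz
  rw [Pi.zero_apply, dist_zero_left]
  exact (hG n z hz).trans_lt hn

section Topology

variable {m : ℕ} {H : Type*} [TopologicalSpace H]
  {I : ModelWithCorners ℝ (EuclideanSpace ℝ (Fin m)) H}
  {M : Type*} [TopologicalSpace M] [ChartedSpace H M] {k r : ℕ} {α : Type*} {u : Filter α}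

theorem tendsto_crMap_iff {f : α → CrMap I M k r} {f₀ : CrMap I M k r} :
    Tendsto f u (𝓝 f₀) ↔ ∀ e ∈ IsManifold.maximalAtlas I ∞ M, ∀ i ≤ r, ∀ C, IsCompact C →
      C ⊆ (e.extend I).target →
        TendstoUniformlyOn (fun a => chartDeriv I e i (f a)) (chartDeriv I e i f₀) u C := by
  simp only [nhds_iInf, tendsto_iInf, nhds_induced, tendsto_comap_iff]
  refine forall₄_congr fun e _ i _ => ?_
  rw [UniformOnFun.tendsto_iff_tendstoUniformlyOn]
  exact ⟨fun h C hC hCt => h C ⟨hC, hCt⟩, fun h C hC => h C hC.1 hC.2⟩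

theorem tendsto_crrMap_iff {K : α → CrrMap I M k r} {K₀ : CrrMap I M k r} :
    Tendsto K u (𝓝 K₀) ↔ ∀ e ∈ IsManifold.maximalAtlas I ∞ M,
      ∀ e' ∈ IsManifold.maximalAtlas I ∞ M, ∀ i ≤ r, ∀ j ≤ r, ∀ C, IsCompact C →
        C ⊆ (e.extend I).target ×ˢ (e'.extend I).target → TendstoUniformlyOn
          (fun a => mixedDeriv i j (e.extend I).target (e'.extend I).target
            (inCharts I e e' (K a).1))
          (mixedDeriv i j (e.extend I).target (e'.extend I).target (inCharts I e e' K₀.1)) u C := by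
  have hnhds : 𝓝 K₀ = _ := nhds_iInf
  simp only [hnhds, nhds_iInf, tendsto_iInf, nhds_induced, tendsto_comap_iff]
  refine forall₄_congr fun e _ e' _ => forall₄_congr fun i _ j _ => ?_
  rw [UniformOnFun.tendsto_iff_tendstoUniformlyOn]
  exact ⟨fun h C hC hCt => h C ⟨hC, hCt⟩, fun h C hC => h C hC.1 hC.2⟩

theorem tendsto_crrMap_zero_of_norm_le {K : α → CrrMap I M k r} {a : α → ℝ}
    (ha : Tendsto a u (𝓝 0))
    (hK : ∀ e ∈ IsManifold.maximalAtlas I ∞ M, ∀ e' ∈ IsManifold.maximalAtlas I ∞ M,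
      ∀ i ≤ r, ∀ j ≤ r, ∀ C, IsCompact C → C ⊆ (e.extend I).target ×ˢ (e'.extend I).target →
        ∃ B, ∀ n, ∀ z ∈ C, ‖mixedDeriv i j (e.extend I).target (e'.extend I).target
          (inCharts I e e' (K n).1) z‖ ≤ B * a n) :
    Tendsto K u (𝓝 0) := by
  refine tendsto_crrMap_iff.2 fun e he e' he' i hi j hj C hC hCt => ?_
  obtain ⟨B, hB⟩ := hK e he e' he' i hi j hj C hC hCt
  have hzero : mixedDeriv i j (e.extend I).target (e'.extend I).target
      (inCharts I e e' (0 : CrrMap I M k r).1) = 0 := mixedDeriv_zero i j _ _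
  rw [hzero]
  exact tendstoUniformlyOn_zero_of_norm_le (W := EuclideanSpace ℝ (Fin m) [×i]→L[ℝ]
    EuclideanSpace ℝ (Fin m) [×j]→L[ℝ] Fin k → Fin k → ℝ)
    (by simpa only [mul_zero] using ha.const_mul B) hB

theorem continuous_eval [IsManifold I ∞ M] (p : M) :
    Continuous fun f : CrMap I M k r => f p := by
  refine continuous_iff_continuousAt.2 fun f₀ => ?_
  have hp : p ∈ (chartAt H p).source := mem_chart_source H p
  have hpt : {(chartAt H p).extend I p} ⊆ ((chartAt H p).extend I).target :=
    Set.singleton_subset_iff.2 (((chartAt H p).extend I).map_source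
      (by rwa [(chartAt H p).extend_source]))
  have hderiv := (tendsto_crMap_iff.1 (tendsto_id (x := 𝓝 f₀)) _
    (IsManifold.chart_mem_maximalAtlas p) 0 (Nat.zero_le r) _ isCompact_singleton hpt).tendsto_at
      (Set.mem_singleton _)
  have heval := ((continuous_eval_const (F := EuclideanSpace ℝ (Fin m) [×0]→L[ℝ]
    EuclideanSpace ℝ (Fin k)) (0 : Fin 0 → EuclideanSpace ℝ (Fin m))).tendsto _).comp hderiv
  simpa only [ContinuousAt, chartDeriv, iteratedFDerivWithin_zero_apply, Function.comp_def, id,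
    (chartAt H p).extend_left_inv hp] using heval

end Topology

namespace BumpSequence

variable {m : ℕ} {H : Type*} [TopologicalSpace H]
  {I : ModelWithCorners ℝ (EuclideanSpace ℝ (Fin m)) H}
  {M : Type*} [TopologicalSpace M] [ChartedSpace H M] {k r : ℕ} (b : BumpSequence I M r)

/-- The function `∑ l ∈ s, w_l f_l v`, where `f_l` are the functions of the sequence. -/
noncomputable def field (s : Finset ℕ) (v : EuclideanSpace ℝ (Fin k)) (w : ℕ → ℝ) : CrMap I M k r :=
  ⟨fun p => ∑ l ∈ s, b.toFun l p • w l • v, contMDiff_finsetSum fun l _ =>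
    ((b.contMDiff l).of_le (by exact_mod_cast le_top)).smul contMDiff_const⟩

theorem field_apply (s : Finset ℕ) (v : EuclideanSpace ℝ (Fin k)) (w : ℕ → ℝ) (p : M) :
    b.field s v w p = ∑ l ∈ s, b.toFun l p • w l • v := rfl

theorem chartDeriv_field (s : Finset ℕ) (v : EuclideanSpace ℝ (Fin k)) (w : ℕ → ℝ)
    {e : OpenPartialHomeomorph M H} (he : e ∈ IsManifold.maximalAtlas I ∞ M)
    {x : EuclideanSpace ℝ (Fin m)} (hx : x ∈ (e.extend I).target) (i : ℕ) :
    chartDeriv I e i (b.field s v w) x =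
      ∑ l ∈ s, (chartDeriv I e i (b.toFun l) x).smulRight (w l • v) :=
  iteratedFDerivWithin_sum_smul (uniqueDiffOn_extend_target e) (fun l => b.contDiffOn he l i) hx _ s

theorem continuous_field (s : Finset ℕ) (v : EuclideanSpace ℝ (Fin k)) :
    Continuous (b.field s v) := by
  refine continuous_iff_continuousAt.2 fun w₀ => tendsto_crMap_iff.2 fun e he i hi C hC hCt => ?_
  obtain ⟨B, hB⟩ := b.isCrBounded e he C hC hCt
  rw [Metric.tendstoUniformlyOn_iff]
  intro ε hε
  have hlim : Tendsto (fun w : ℕ → ℝ => ∑ l ∈ s, B * ‖w₀ l • v - w l • v‖) (𝓝 w₀) (𝓝 0) := by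
    have hcont : Continuous fun w : ℕ → ℝ => ∑ l ∈ s, B * ‖w₀ l • v - w l • v‖ := by fun_prop
    simpa only [sub_self, norm_zero, mul_zero, Finset.sum_const_zero] using hcont.tendsto w₀
  have hsub : ∀ (D : EuclideanSpace ℝ (Fin m) [×i]→L[ℝ] ℝ) (y y' : EuclideanSpace ℝ (Fin k)),
      D.smulRight y - D.smulRight y' = D.smulRight (y - y') := fun D y y' => by
    ext1
    simp [smul_sub]
  filter_upwards [hlim.eventually_lt_const hε] with w hw x hx
  refine lt_of_le_of_lt ?_ hw
  rw [dist_eq_norm, b.chartDeriv_field s v _ he (hCt hx), b.chartDeriv_field s v _ he (hCt hx),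
    ← Finset.sum_sub_distrib]
  refine (norm_sum_le _ _).trans (Finset.sum_le_sum fun l _ => ?_)
  rw [hsub, ContinuousMultilinearMap.norm_smulRight]
  exact mul_le_mul_of_nonneg_right (hB i hi l x hx) (norm_nonneg _)

/-- The kernel `(p, q) ↦ ∑ l ∈ s, f_l(p) f_l(q) A`; for `A = v vᵀ` it is the covariance of
`∑ l ∈ s, ξ_l f_l v` with independent standard Gaussian `ξ_l`. -/
noncomputable def kernel (s : Finset ℕ) (A : Fin k → Fin k → ℝ) : CrrMap I M k r :=
  ⟨fun z => ∑ l ∈ s, b.toFun l z.1 • b.toFun l z.2 • A, fun e he e' he' =>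
    isCrrOn_sum_smul s (uniqueDiffOn_extend_target e) (uniqueDiffOn_extend_target e')
      (fun l => b.contDiffOn he l r) fun l => (b.contDiffOn he' l r).smul_const A⟩

/-- Since the functions have disjoint supports, the bound does not depend on `s`. -/
theorem exists_norm_mixedDeriv_kernel_le {e e' : OpenPartialHomeomorph M H}
    (he : e ∈ IsManifold.maximalAtlas I ∞ M) (he' : e' ∈ IsManifold.maximalAtlas I ∞ M) {i j : ℕ}
    (hi : i ≤ r) (hj : j ≤ r) {C : Set (EuclideanSpace ℝ (Fin m) × EuclideanSpace ℝ (Fin m))}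
    (hC : IsCompact C) (hCt : C ⊆ (e.extend I).target ×ˢ (e'.extend I).target) :
    ∃ B, ∀ (s : Finset ℕ) (A : Fin k → Fin k → ℝ), ∀ z ∈ C,
      ‖mixedDeriv i j (e.extend I).target (e'.extend I).target
        (inCharts I e e' (b.kernel s A).1) z‖ ≤ B * ‖A‖ := by
  obtain ⟨B, hB⟩ := b.isCrBounded e he (Prod.fst '' C) (hC.image continuous_fst)
    (Set.image_subset_iff.2 fun z hz => (hCt hz).1)
  obtain ⟨B', hB'⟩ := b.isCrBounded e' he' (Prod.snd '' C) (hC.image continuous_snd)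
    (Set.image_subset_iff.2 fun z hz => (hCt hz).2)
  refine ⟨B * B', fun s A z hz => ?_⟩
  have hfst := fun l => hB i hi l z.1 (Set.mem_image_of_mem _ hz)
  have hsnd := fun l => hB' j hj l z.2 (Set.mem_image_of_mem _ hz)
  rw [mul_assoc]
  refine norm_mixedDeriv_sum_smul_le s (uniqueDiffOn_extend_target e)
    (uniqueDiffOn_extend_target e') (fun l => b.contDiffOn he l i)
    (fun l => (b.contDiffOn he' l j).smul_const A) (hCt hz) ((norm_nonneg _).trans (hfst 0))
    (mul_nonneg ((norm_nonneg _).trans (hsnd 0)) (norm_nonneg A)) hfst (fun l => ?_)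
    fun l l' hl => b.chartDeriv_eq_zero_or e (hCt hz).1 i hl
  rw [iteratedFDerivWithin_smul_const_eq_smulRight (uniqueDiffOn_extend_target e')
    (b.contDiffOn he' l j) (hCt hz).2, ContinuousMultilinearMap.norm_smulRight]
  exact mul_le_mul_of_nonneg_right (hsnd l) (norm_nonneg A)

theorem tendsto_kernel {α : Type*} {u : Filter α} (s : α → Finset ℕ) {A : α → Fin k → Fin k → ℝ}
    (hA : Tendsto A u (𝓝 0)) : Tendsto (fun n => b.kernel (s n) (A n)) u (𝓝 0) := by
  refine tendsto_crrMap_zero_of_norm_le (tendsto_zero_iff_norm_tendsto_zero.1 hA) ?_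
  intro e he e' he' i hi j hj C hC hCt
  obtain ⟨B, hB⟩ := b.exists_norm_mixedDeriv_kernel_le (k := k) he he' hi hj hC hCt
  exact ⟨B, fun n => hB (s n) (A n)⟩

end BumpSequence

/-! ### A bounded continuous function of the derivatives of order `r` -/

theorem tendsto_ciSup_of_tendstoUniformly {α ι : Type*} [Nonempty ι] {u : Filter α}
    {F : α → ι → ℝ} {f : ι → ℝ} (h : TendstoUniformly F f u)
    (hF : ∀ a, BddAbove (Set.range (F a))) (hf : BddAbove (Set.range f)) :
    Tendsto (fun a => ⨆ l, F a l) u (𝓝 (⨆ l, f l)) := by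
  rw [Metric.tendsto_nhds]
  intro ε hε
  filter_upwards [Metric.tendstoUniformly_iff.1 h (ε / 2) (half_pos hε)] with a ha
  refine lt_of_le_of_lt (abs_sub_le_iff.2 ⟨?_, ?_⟩) (half_lt_self hε) <;>
    rw [sub_le_iff_le_add'] <;> refine ciSup_le fun l => ?_
  · linarith [(abs_lt.1 (ha l)).1, le_ciSup hf l]
  · linarith [(abs_lt.1 (ha l)).2, le_ciSup (hF a) l]

namespace JetProbe

variable {m : ℕ} {H : Type*} [TopologicalSpace H]
  {I : ModelWithCorners ℝ (EuclideanSpace ℝ (Fin m)) H}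
  {M : Type*} [TopologicalSpace M] [ChartedSpace H M] {k r : ℕ} (J : JetProbe I M r)

/-- The derivative of `f` of order `r` at the `l`-th point, in the directions `J.vec`. -/
noncomputable def jet (l : ℕ) (f : CrMap I M k r) : EuclideanSpace ℝ (Fin k) :=
  chartDeriv I J.chart r f (J.point l) J.vec

/-- The supremum of the sizes of these derivatives of `f`, truncated at `1`: the bounded continuous
function that separates Gaussian measures from the Dirac measure at `0`. -/
noncomputable def test (f : CrMap I M k r) : ℝ := ⨆ l, min 1 ‖J.jet l f‖

variable (f : CrMap I M k r)

theorem bddAbove_min_jet : BddAbove (Set.range fun l => min 1 ‖J.jet l f‖) :=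
  ⟨1, Set.forall_mem_range.2 fun _ => min_le_left _ _⟩

theorem min_jet_le_test (l : ℕ) : min 1 ‖J.jet l f‖ ≤ J.test f :=
  le_ciSup (J.bddAbove_min_jet f) l

theorem test_nonneg : 0 ≤ J.test f :=
  (le_min zero_le_one (norm_nonneg _)).trans (J.min_jet_le_test f 0)

theorem test_le_one : J.test f ≤ 1 :=
  ciSup_le fun _ => min_le_left _ _

theorem jet_zero (l : ℕ) : J.jet l (0 : CrMap I M k r) = 0 := by
  have h : ⇑(0 : CrMap I M k r) ∘ (J.chart.extend I).symm = fun _ => 0 := rfl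
  rw [jet, chartDeriv, h, iteratedFDerivWithin_fun_zero]
  rfl

theorem test_zero : J.test (0 : CrMap I M k r) = 0 := by
  simp only [test, jet_zero, norm_zero, zero_le_one, inf_of_le_right, ciSup_const]

theorem continuous_test : Continuous (J.test : CrMap I M k r → ℝ) := by
  refine continuous_iff_continuousAt.2 fun f₀ => ?_
  have hderiv := (tendsto_crMap_iff.1 (tendsto_id (x := 𝓝 f₀)) _ J.chart_mem r le_rfl J.compact
    J.isCompact (J.subset_interior.trans interior_subset)).comp J.point
  rw [show J.point ⁻¹' J.compact = Set.univ from Set.eq_univ_of_forall J.point_mem,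
    tendstoUniformlyOn_univ] at hderiv
  have hmin : UniformContinuous fun D : EuclideanSpace ℝ (Fin m) [×r]→L[ℝ]
      EuclideanSpace ℝ (Fin k) => min 1 ‖D J.vec‖ :=
    (LipschitzWith.id.const_min 1).uniformContinuous.comp <| uniformContinuous_norm.comp
      (ContinuousMultilinearMap.uniformContinuous_eval_const J.vec)
  exact tendsto_ciSup_of_tendstoUniformly (hmin.comp_tendstoUniformly hderiv)
    (fun f => J.bddAbove_min_jet f) (J.bddAbove_min_jet f₀)

end JetProbe

theorem BumpSequence.jet_field {m : ℕ} {H : Type*} [TopologicalSpace H]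
    {I : ModelWithCorners ℝ (EuclideanSpace ℝ (Fin m)) H}
    {M : Type*} [TopologicalSpace M] [ChartedSpace H M] {k r : ℕ} (b : BumpSequence I M r)
    {s : Finset ℕ} {l : ℕ} (hl : l ∈ s) (v : EuclideanSpace ℝ (Fin k)) (w : ℕ → ℝ) :
    b.jet l (b.field s v w) = b.height • w l • v := by
  rw [JetProbe.jet, b.chartDeriv_field s v w b.chart_mem
    (interior_subset (b.subset_interior (b.point_mem l))), sum_apply,
    Finset.sum_eq_single_of_mem l hl fun l' _ hl' => ?_]
  · rw [ContinuousMultilinearMap.smulRight_apply, b.chartDeriv_point]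
  · rw [b.chartDeriv_point_of_ne hl', ContinuousMultilinearMap.smulRight_apply, zero_apply,
      zero_smul]

/-! ### Gaussian fields with equal covariance functions -/

section GaussianFamily

variable {Ω Ω' T : Type*} [MeasurableSpace Ω] [MeasurableSpace Ω'] {P : Measure Ω}
  {P' : Measure Ω'} {X : T → Ω → ℝ} {X' : T → Ω' → ℝ}

theorem map_eq_of_hasGaussianLaw_of_covariance_eq [Finite T]
    (hX : HasGaussianLaw (fun w t => X t w) P) (hX' : HasGaussianLaw (fun w t => X' t w) P')
    (hmean : ∀ t, ∫ w, X t w ∂P = ∫ w, X' t w ∂P')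
    (hcov : ∀ s t, cov[X s, X t; P] = cov[X' s, X' t; P']) :
    P.map (fun w t => X t w) = P'.map (fun w t => X' t w) := by
  have := Fintype.ofFinite T
  have := hX.isProbabilityMeasure
  have := hX'.isProbabilityMeasure
  have hL := hX.toLp_pi 2
  have hL' := hX'.toLp_pi 2
  have := hL.isGaussian_map
  have := hL'.isGaussian_map
  let L := (PiLp.continuousLinearEquiv 2 ℝ fun _ : T => ℝ).symm
  have hmap : P.map (fun w => WithLp.toLp 2 fun t => X t w) =
      P'.map (fun w => WithLp.toLp 2 fun t => X' t w) := by
    refine IsGaussian.ext ?_ ?_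
    · simp only [id_eq]
      rw [integral_map hL.aemeasurable (by fun_prop), integral_map hL'.aemeasurable (by fun_prop)]
      change ∫ w, L (fun t => X t w) ∂P = ∫ w, L (fun t => X' t w) ∂P'
      rw [L.integral_comp_comm, L.integral_comp_comm]
      congr 1
      ext t
      rw [eval_integral fun t => (hX.eval t).integrable,
        eval_integral fun t => (hX'.eval t).integrable, hmean]
    · ext x y
      rw [covarianceBilin_apply_pi fun t => (hX.eval t).memLp_two,
        covarianceBilin_apply_pi fun t => (hX'.eval t).memLp_two]
      simp only [hcov]
  apply (MeasurableEquiv.toLp 2 (T → ℝ)).map_measurableEquiv_injective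
  rw [AEMeasurable.map_map_of_aemeasurable (by fun_prop) hX.aemeasurable,
    AEMeasurable.map_map_of_aemeasurable (by fun_prop) hX'.aemeasurable]
  exact hmap

theorem map_eq_of_isGaussianProcess_of_covariance_eq
    (hX : IsGaussianProcess X P) (hX' : IsGaussianProcess X' P')
    (hm : ∀ t, Measurable (X t)) (hm' : ∀ t, Measurable (X' t))
    (hmean : ∀ t, ∫ w, X t w ∂P = ∫ w, X' t w ∂P')
    (hcov : ∀ s t, cov[X s, X t; P] = cov[X' s, X' t; P']) :
    P.map (fun w t => X t w) = P'.map (fun w t => X' t w) := by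
  have := hX.isProbabilityMeasure
  have hlim := isProjectiveLimit_map (measurable_pi_lambda _ hm).aemeasurable (P := P)
  have hlim' := isProjectiveLimit_map (measurable_pi_lambda _ hm').aemeasurable (P := P')
  have hfin : (fun J : Finset T => P.map fun w => J.restrict fun t => X t w) =
      fun J => P'.map fun w => J.restrict fun t => X' t w := by
    funext J
    exact map_eq_of_hasGaussianLaw_of_covariance_eq (hX.hasGaussianLaw J) (hX'.hasGaussianLaw J)
      (fun t => hmean t) fun s t => hcov s t
  exact hlim.unique (hfin ▸ hlim')

end GaussianFamily

section Field

variable {m : ℕ} {H : Type*} [TopologicalSpace H]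
  {I : ModelWithCorners ℝ (EuclideanSpace ℝ (Fin m)) H}
  {M : Type*} [TopologicalSpace M] [ChartedSpace H M] {k r : ℕ}
  {Ω : Type*} [MeasurableSpace Ω] {P : Measure Ω} {X : Ω → CrMap I M k r}
  {Ω' : Type*} [MeasurableSpace Ω'] {P' : Measure Ω'} {X' : Ω' → CrMap I M k r}

theorem IsGaussianField.isGaussianProcess (hX : IsGaussianField P X) :
    IsGaussianProcess (fun (q : M × Fin k) w => X w q.1 q.2) P where
  hasGaussianLaw J := by
    have := hX.gaussian J.card fun i => (J.equivFin.symm i).1.1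
    have hlaw : HasGaussianLaw (fun w i => X w (J.equivFin.symm i).1.1) P :=
      IsGaussian.hasGaussianLaw
    let L : (Fin J.card → EuclideanSpace ℝ (Fin k)) →L[ℝ] J → ℝ :=
      ContinuousLinearMap.pi fun q =>
        (EuclideanSpace.proj q.1.2).comp (ContinuousLinearMap.proj (J.equivFin q))
    have hrestrict : (fun w => J.restrict fun q : M × Fin k => X w q.1 q.2) =
        fun w => L fun i => X w (J.equivFin.symm i).1.1 := by
      funext w q
      change X w q.1.1 q.1.2 = X w (J.equivFin.symm (J.equivFin q)).1.1 q.1.2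
      rw [Equiv.symm_apply_apply]
    exact hrestrict ▸ hlaw.map_fun L

theorem IsGaussianField.integrable_eval (hX : IsGaussianField P X) (p : M) :
    Integrable (fun w => X w p) P := by
  have := hX.gaussian 1 fun _ => p
  have hlaw : HasGaussianLaw (fun w (_ : Fin 1) => X w p) P := IsGaussian.hasGaussianLaw
  exact (hlaw.eval 0).integrable

theorem IsGaussianField.integral_eval_apply (hX : IsGaussianField P X) (p : M) (a : Fin k) :
    ∫ w, X w p a ∂P = 0 := by
  have h := (EuclideanSpace.proj a : EuclideanSpace ℝ (Fin k) →L[ℝ] ℝ).integral_comp_comm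
    (hX.integrable_eval p)
  rwa [hX.centered, map_zero] at h

theorem IsGaussianField.covariance_eval_apply (hX : IsGaussianField P X) (p q : M)
    (a b : Fin k) :
    cov[fun w => X w p a, fun w => X w q b; P] = covarianceFun P X (p, q) a b := by
  have hproc := hX.isGaussianProcess
  have := hproc.isProbabilityMeasure
  rw [covariance_eq_sub (hproc.hasGaussianLaw_eval (p, a)).memLp_two
    (hproc.hasGaussianLaw_eval (q, b)).memLp_two, hX.integral_eval_apply, zero_mul, sub_zero]
  rfl

variable [IsManifold I ∞ M]

theorem measurable_eval_apply (p : M) (a : Fin k) :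
    Measurable fun f : CrMap I M k r => f p a :=
  (EuclideanSpace.proj a : EuclideanSpace ℝ (Fin k) →L[ℝ] ℝ).continuous.measurable.comp
    (continuous_eval p).measurable

theorem IsGaussianField.map_eval_eq_of_covarianceFun_eq (hX : IsGaussianField P X)
    (hX' : IsGaussianField P' X') (h : covarianceFun P X = covarianceFun P' X') :
    P.map (fun w (q : M × Fin k) => X w q.1 q.2) =
      P'.map (fun w (q : M × Fin k) => X' w q.1 q.2) :=
  map_eq_of_isGaussianProcess_of_covariance_eq (T := M × Fin k) (X := fun q w => X w q.1 q.2)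
    (X' := fun q w => X' w q.1 q.2) hX.isGaussianProcess hX'.isGaussianProcess
    (fun _ => (measurable_eval_apply _ _).comp hX.measurable)
    (fun _ => (measurable_eval_apply _ _).comp hX'.measurable)
    (fun _ => by rw [hX.integral_eval_apply, hX'.integral_eval_apply])
    fun _ _ => by rw [hX.covariance_eval_apply, hX'.covariance_eval_apply, h]

theorem IsGaussianField.id_map (hX : IsGaussianField P X) : IsGaussianField (P.map X) id where
  measurable := measurable_id
  gaussian j p := by
    change IsGaussian ((P.map X).map fun f i => f (p i))
    rw [Measure.map_map (measurable_pi_lambda _ fun i => (continuous_eval (p i)).measurable)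
      hX.measurable]
    exact hX.gaussian j p
  centered p :=
    (integral_map hX.measurable.aemeasurable
      (continuous_eval p).measurable.aestronglyMeasurable).trans (hX.centered p)

theorem IsGaussianField.covarianceFun_id_map (hX : IsGaussianField P X) :
    covarianceFun (P.map X) id = covarianceFun P X := by
  funext z a b
  exact integral_map hX.measurable.aemeasurable
    ((measurable_eval_apply z.1 a).mul (measurable_eval_apply z.2 b)).aestronglyMeasurable

end Field

/-! ### Derivatives as functions of the evaluations -/

section DifferenceQuotient

variable {E F : Type*} [NormedAddCommGroup E] [NormedSpace ℝ E] [NormedAddCommGroup F]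
  [NormedSpace ℝ F] {S : Set E} {r i : ℕ} {y : E}

theorem tendsto_differenceQuotient_iteratedFDerivWithin {g : E → F} (hS : UniqueDiffOn ℝ S)
    (hg : ContDiffOn ℝ r g S) (hi : i < r) (hy : y ∈ interior S) (V : Fin (i + 1) → E) :
    Tendsto (fun n : ℕ => (n : ℝ) • (iteratedFDerivWithin ℝ i g S (y + (n : ℝ)⁻¹ • V 0)
      (Fin.tail V) - iteratedFDerivWithin ℝ i g S y (Fin.tail V))) atTop
      (𝓝 (iteratedFDerivWithin ℝ (i + 1) g S y V)) := by
  have hderiv := (hg.differentiableOn_iteratedFDerivWithin (m := i) (by exact_mod_cast hi) hS y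
    (interior_subset hy)).hasFDerivWithinAt.hasFDerivAt (mem_interior_iff_mem_nhds.1 hy)
  have hnorm : Tendsto (fun n : ℕ => ‖(n : ℝ)‖) atTop atTop := by
    simpa only [Real.norm_natCast] using tendsto_natCast_atTop_atTop (R := ℝ)
  exact ((continuous_eval_const (F := E [×i]→L[ℝ] F) (Fin.tail V)).tendsto _).comp
    (hderiv.lim (V 0) hnorm)

theorem measurable_iteratedFDerivWithin_apply [MeasurableSpace F] [BorelSpace F]
    [SecondCountableTopology F] {α : Type*} {mα : MeasurableSpace α} {g : α → E → F}
    (hS : UniqueDiffOn ℝ S) (hg : ∀ w, ContDiffOn ℝ r (g w) S)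
    (hm : ∀ x ∈ interior S, Measurable fun w => g w x) (hi : i ≤ r) (hy : y ∈ interior S)
    (V : Fin i → E) : Measurable fun w => iteratedFDerivWithin ℝ i (g w) S y V := by
  induction i generalizing y with
  | zero => exact hm y hy
  | succ i ih =>
    have hnear : Tendsto (fun n : ℕ => y + (n : ℝ)⁻¹ • V 0) atTop (𝓝 y) := by
      simpa only [zero_smul, add_zero] using tendsto_const_nhds.add
        ((tendsto_inv_atTop_nhds_zero_nat (𝕜 := ℝ)).smul_const (V 0))
    obtain ⟨n₀, hn₀⟩ := eventually_atTop.1 (hnear.eventually (isOpen_interior.mem_nhds hy))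
    refine measurable_of_tendsto_metrizable (fun n => ?_) (tendsto_pi_nhds.2 fun w =>
      (tendsto_differenceQuotient_iteratedFDerivWithin hS (hg w) hi hy V).comp
        (tendsto_add_atTop_nat n₀))
    exact ((ih (Nat.le_of_succ_le hi) (hn₀ _ (Nat.le_add_left n₀ n)) _).fun_sub
      (ih (Nat.le_of_succ_le hi) hy _)).fun_const_smul _

end DifferenceQuotient

namespace JetProbe

variable {m : ℕ} {H : Type*} [TopologicalSpace H]
  {I : ModelWithCorners ℝ (EuclideanSpace ℝ (Fin m)) H}
  {M : Type*} [TopologicalSpace M] [ChartedSpace H M] {k r : ℕ} (J : JetProbe I M r)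

theorem measurable_test_comp {α : Type*} {mα : MeasurableSpace α} {X : α → CrMap I M k r}
    (hX : ∀ p a, Measurable fun w => X w p a) : Measurable fun w => J.test (X w) :=
  have heval (p : M) : Measurable fun w => X w p :=
    (MeasurableEquiv.toLp 2 (Fin k → ℝ)).measurable.comp (measurable_pi_lambda _ (hX p))
  Measurable.iSup fun l => measurable_const.min <| Measurable.norm <|
    measurable_iteratedFDerivWithin_apply (uniqueDiffOn_extend_target J.chart)
      (fun w => contDiffOn_comp_extend_symm J.chart_mem (by exact_mod_cast le_top)
        (X w).contMDiff)
      (fun _ _ => heval _) le_rfl (J.subset_interior (J.point_mem l)) J.vec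

variable (k) in
theorem exists_measurable_test_eq_comp_eval :
    ∃ h : (M × Fin k → ℝ) → ℝ, Measurable h ∧
      ∀ f : CrMap I M k r, J.test f = h fun q => f q.1 q.2 := by
  let eval (f : CrMap I M k r) (q : M × Fin k) : ℝ := f q.1 q.2
  have hm : Measurable[MeasurableSpace.comap eval MeasurableSpace.pi]
      fun f : CrMap I M k r => J.test f :=
    J.measurable_test_comp (X := id) fun p a =>
      (measurable_pi_apply (p, a)).comp (comap_measurable eval)
  obtain ⟨h, hh, heq⟩ := hm.exists_eq_measurable_comp
  exact ⟨h, hh, congrFun heq⟩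

theorem integral_test_eq_of_covarianceFun_eq [IsManifold I ∞ M]
    {Ω : Type*} [MeasurableSpace Ω] {P : Measure Ω} {X : Ω → CrMap I M k r}
    {Ω' : Type*} [MeasurableSpace Ω'] {P' : Measure Ω'} {X' : Ω' → CrMap I M k r}
    (hX : IsGaussianField P X) (hX' : IsGaussianField P' X')
    (h : covarianceFun P X = covarianceFun P' X') :
    ∫ w, J.test (X w) ∂P = ∫ w, J.test (X' w) ∂P' := by
  obtain ⟨g, hg, htest⟩ := J.exists_measurable_test_eq_comp_eval k
  have hm : Measurable fun w (q : M × Fin k) => X w q.1 q.2 :=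
    measurable_pi_lambda _ fun _ => (measurable_eval_apply _ _).comp hX.measurable
  have hm' : Measurable fun w (q : M × Fin k) => X' w q.1 q.2 :=
    measurable_pi_lambda _ fun _ => (measurable_eval_apply _ _).comp hX'.measurable
  simp only [htest]
  rw [← integral_map hm.aemeasurable hg.aestronglyMeasurable,
    ← integral_map hm'.aemeasurable hg.aestronglyMeasurable,
    hX.map_eval_eq_of_covarianceFun_eq hX' h]

end JetProbe

/-! ### Sequences of independent Gaussian variables -/

theorem infinitePi_real_exists_notMem {ι α : Type*} [MeasurableSpace α] (μ : Measure α)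
    [IsProbabilityMeasure μ] {A : Set α} (hA : MeasurableSet A) (s : Finset ι) :
    (Measure.infinitePi fun _ : ι => μ).real {w | ∃ l ∈ s, w l ∉ A} = 1 - μ.real A ^ s.card := by
  have hcompl : {w : ι → α | ∃ l ∈ s, w l ∉ A} = ((s : Set ι).pi fun _ => A)ᶜ := by
    ext w
    simp only [Set.mem_ofPred_eq, Set.mem_compl_iff, Set.mem_pi, Finset.mem_coe, not_forall,
      exists_prop]
  rw [hcompl, probReal_compl_eq_one_sub (MeasurableSet.pi s.countable_toSet fun _ _ => hA),
    measureReal_def, Measure.infinitePi_pi _ fun _ _ => hA, Finset.prod_const, ENNReal.toReal_pow,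
    measureReal_def]

theorem gaussianReal_real_ball_lt_one (x : ℝ) {v : NNReal} (hv : v ≠ 0) (c t : ℝ) :
    (gaussianReal x v).real (Metric.ball c t) < 1 := by
  have := (gaussianReal_absolutelyContinuous' x hv).isOpenPosMeasure
  have hpos : 0 < (gaussianReal x v).real (Metric.closedBall c t)ᶜ := by
    refine ENNReal.toReal_pos (Metric.isClosed_closedBall.isOpen_compl.measure_ne_zero _ ?_)
      (measure_ne_top _ _)
    exact Filter.nonempty_of_mem (Bornology.isBounded_def.1 Metric.isBounded_closedBall)
  rw [probReal_compl_eq_one_sub Metric.isClosed_closedBall.measurableSet] at hpos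
  exact (measureReal_mono Metric.ball_subset_closedBall).trans_lt (sub_pos.1 hpos)

/-- The law of a sequence of independent standard Gaussian variables. -/
noncomputable def whiteNoise : Measure (ℕ → ℝ) :=
  Measure.infinitePi fun _ => gaussianReal 0 1

instance : IsProbabilityMeasure whiteNoise :=
  inferInstanceAs (IsProbabilityMeasure (Measure.infinitePi fun _ => gaussianReal 0 1))

theorem hasLaw_whiteNoise (l : ℕ) : HasLaw (fun w => w l) (gaussianReal 0 1) whiteNoise :=
  ⟨(measurable_pi_apply l).aemeasurable, Measure.infinitePi_map_eval _ l⟩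

theorem iIndepFun_whiteNoise : iIndepFun (fun (l : ℕ) (w : ℕ → ℝ) => w l) whiteNoise :=
  iIndepFun_infinitePi (X := fun _ x => x) fun _ => measurable_id

theorem hasGaussianLaw_restrict_whiteNoise (s : Finset ℕ) :
    HasGaussianLaw (fun (w : ℕ → ℝ) (l : s) => w l) whiteNoise :=
  (iIndepFun_whiteNoise.precomp Subtype.val_injective).hasGaussianLaw
    fun l => (hasLaw_whiteNoise l).hasGaussianLaw

theorem integral_whiteNoise (l : ℕ) : ∫ w, w l ∂whiteNoise = 0 :=
  (hasLaw_whiteNoise l).integral_eq.trans integral_id_gaussianReal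

theorem integrable_mul_whiteNoise (l l' : ℕ) :
    Integrable (fun w : ℕ → ℝ => w l * w l') whiteNoise :=
  (hasLaw_whiteNoise l).hasGaussianLaw.memLp_two.integrable_mul
    (hasLaw_whiteNoise l').hasGaussianLaw.memLp_two

theorem integral_mul_whiteNoise (l l' : ℕ) :
    ∫ w, w l * w l' ∂whiteNoise = if l = l' then 1 else 0 := by
  split_ifs with h
  · subst h
    have hvar : Var[fun w => w l; whiteNoise] = 1 :=
      (hasLaw_whiteNoise l).variance_eq.trans variance_id_gaussianReal
    rw [variance_of_integral_eq_zero (hasLaw_whiteNoise l).aemeasurable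
      (integral_whiteNoise l)] at hvar
    simpa only [sq] using hvar
  · rw [(iIndepFun_whiteNoise.indepFun h).integral_fun_mul_eq_mul_integral
      (measurable_pi_apply l).aestronglyMeasurable (measurable_pi_apply l').aestronglyMeasurable,
      integral_whiteNoise, zero_mul]

theorem exists_le_whiteNoise_real_exists_le_abs {c : ℝ} (hc : c < 1) (t : ℝ) :
    ∃ s : Finset ℕ, c ≤ whiteNoise.real {w | ∃ l ∈ s, t ≤ |w l|} := by
  obtain ⟨N, hN⟩ := exists_pow_lt_of_lt_one (sub_pos.2 hc)
    (gaussianReal_real_ball_lt_one 0 one_ne_zero 0 t)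
  have h := infinitePi_real_exists_notMem (gaussianReal 0 1) (Metric.isOpen_ball.measurableSet :
    MeasurableSet (Metric.ball (0 : ℝ) t)) (Finset.range N)
  simp only [mem_ball_zero_iff, Real.norm_eq_abs, not_lt, Finset.card_range] at h
  refine ⟨Finset.range N, ?_⟩
  rw [whiteNoise, h]
  linarith

/-! ### Gaussian combinations of bumps -/

namespace BumpSequence

variable {m : ℕ} {H : Type*} [TopologicalSpace H]
  {I : ModelWithCorners ℝ (EuclideanSpace ℝ (Fin m)) H}
  {M : Type*} [TopologicalSpace M] [ChartedSpace H M] {k r : ℕ} (b : BumpSequence I M r)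
  (s : Finset ℕ) (v : EuclideanSpace ℝ (Fin k))

theorem isGaussianField_field : IsGaussianField whiteNoise (b.field s v) where
  measurable := (b.continuous_field s v).measurable
  gaussian j p := by
    let L : (s → ℝ) →L[ℝ] Fin j → EuclideanSpace ℝ (Fin k) :=
      ContinuousLinearMap.pi fun i => ∑ l : s, b.toFun l (p i) •
        (ContinuousLinearMap.proj l : (s → ℝ) →L[ℝ] ℝ).smulRight v
    have hL : (fun w i => b.field s v w (p i)) = fun w => L fun l => w l := by
      funext w i
      simp only [L, field_apply, ContinuousLinearMap.coe_pi', sum_apply, smul_apply,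
        ContinuousLinearMap.smulRight_apply, ContinuousLinearMap.proj_apply]
      exact (Finset.sum_coe_sort s fun l => b.toFun l (p i) • w l • v).symm
    exact hL ▸ ((hasGaussianLaw_restrict_whiteNoise s).map_fun L).isGaussian_map
  centered p := by
    have hinteg (l : ℕ) : Integrable (fun w : ℕ → ℝ => b.toFun l p • w l • v) whiteNoise :=
      ((hasLaw_whiteNoise l).hasGaussianLaw.integrable.smul_const v).fun_smul (b.toFun l p)
    simp only [field_apply]
    rw [integral_finsetSum _ fun l _ => hinteg l]
    simp only [integral_smul, integral_smul_const, integral_whiteNoise, zero_smul, smul_zero,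
      Finset.sum_const_zero]

theorem covarianceFun_field :
    covarianceFun whiteNoise (b.field s v) = (b.kernel s fun a a' => v a * v a').1 := by
  funext ⟨p, q⟩ a a'
  have hexpand (w : ℕ → ℝ) : b.field s v w p a * b.field s v w q a' =
      ∑ l ∈ s, ∑ l' ∈ s, b.toFun l p * b.toFun l' q * (v a * v a') * (w l * w l') := by
    simp only [field_apply, WithLp.ofLp_sum, WithLp.ofLp_smul, Finset.sum_apply, Pi.smul_apply,
      smul_eq_mul, Finset.sum_mul_sum]
    exact Finset.sum_congr rfl fun l _ => Finset.sum_congr rfl fun l' _ => by ring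
  calc ∫ w, b.field s v w p a * b.field s v w q a' ∂whiteNoise
      = ∑ l ∈ s, ∑ l' ∈ s,
          b.toFun l p * b.toFun l' q * (v a * v a') * if l = l' then 1 else 0 := by
        simp only [hexpand]
        rw [integral_finsetSum _ fun l _ => integrable_finsetSum _ fun l' _ =>
          (integrable_mul_whiteNoise l l').const_mul _]
        refine Finset.sum_congr rfl fun l _ => ?_
        rw [integral_finsetSum _ fun l' _ => (integrable_mul_whiteNoise l l').const_mul _]
        simp only [integral_const_mul, integral_mul_whiteNoise]
    _ = ∑ l ∈ s, b.toFun l p * b.toFun l q * (v a * v a') :=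
        Finset.sum_congr rfl fun l hl => by
          simp only [mul_ite, mul_one, mul_zero, Finset.sum_ite_eq, if_pos hl]
    _ = (b.kernel s fun a a' => v a * v a').1 (p, q) a a' := by
        simp only [kernel, Finset.sum_apply, Pi.smul_apply, smul_eq_mul, mul_assoc]

variable {v}

theorem exists_half_le_integral_test_field (hv : v ≠ 0) :
    ∃ s : Finset ℕ, 1 / 2 ≤ ∫ w, b.test (b.field s v w) ∂whiteNoise := by
  have hc : 0 < |b.height| * ‖v‖ := mul_pos (abs_pos.2 b.height_ne_zero) (norm_pos_iff.2 hv)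
  obtain ⟨s, hs⟩ := exists_le_whiteNoise_real_exists_le_abs one_half_lt_one (|b.height| * ‖v‖)⁻¹
  have hinteg : Integrable (fun w => b.test (b.field s v w)) whiteNoise :=
    Integrable.of_bound (b.continuous_test.comp (b.continuous_field s v)).aestronglyMeasurable 1
      (Eventually.of_forall fun w =>
        (Real.norm_of_nonneg (b.test_nonneg _)).trans_le (b.test_le_one _))
  have hsub : {w : ℕ → ℝ | ∃ l ∈ s, (|b.height| * ‖v‖)⁻¹ ≤ |w l|} ⊆
      {w | 1 ≤ b.test (b.field s v w)} := by
    rintro w ⟨l, hl, hlw⟩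
    refine (le_min le_rfl ?_).trans (b.min_jet_le_test _ l)
    rw [b.jet_field hl, norm_smul, norm_smul, Real.norm_eq_abs, Real.norm_eq_abs, mul_left_comm]
    exact (inv_le_iff_one_le_mul₀ hc).1 hlw
  refine ⟨s, ?_⟩
  calc 1 / 2 ≤ whiteNoise.real {w | ∃ l ∈ s, (|b.height| * ‖v‖)⁻¹ ≤ |w l|} := hs
    _ ≤ 1 * whiteNoise.real {w | 1 ≤ b.test (b.field s v w)} := by
        rw [one_mul]
        exact measureReal_mono hsub
    _ ≤ ∫ w, b.test (b.field s v w) ∂whiteNoise :=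
        mul_meas_ge_le_integral_of_nonneg (Eventually.of_forall fun w => b.test_nonneg _) hinteg 1

end BumpSequence

theorem exists_seq_isGaussianField_tendsto_zero {m k : ℕ} (hm : 0 < m) (hk : 0 < k) (r : ℕ)
    {H : Type*} [TopologicalSpace H] (I : ModelWithCorners ℝ (EuclideanSpace ℝ (Fin m)) H)
    (M : Type*) [TopologicalSpace M] [ChartedSpace H M] [IsManifold I ∞ M] [T2Space M]
    [Nonempty M] :
    ∃ (J : JetProbe I M r) (X : ℕ → (ℕ → ℝ) → CrMap I M k r) (K : ℕ → CrrMap I M k r),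
      (∀ n, IsGaussianField whiteNoise (X n)) ∧
      (∀ n, covarianceFun whiteNoise (X n) = (K n).1) ∧
      Tendsto K atTop (𝓝 0) ∧
      ∀ n, 1 / 2 ≤ ∫ w, J.test (X n w) ∂whiteNoise := by
  obtain ⟨b⟩ := exists_bumpSequence I M hm r
  let u : EuclideanSpace ℝ (Fin k) := EuclideanSpace.single ⟨0, hk⟩ 1
  let v (n : ℕ) : EuclideanSpace ℝ (Fin k) := (1 / ((n : ℝ) + 1)) • u
  have hv_ne (n : ℕ) : v n ≠ 0 :=
    smul_ne_zero Nat.one_div_pos_of_nat.ne' ((PiLp.single_eq_zero_iff _ _).not.2 one_ne_zero)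
  have hv : Tendsto v atTop (𝓝 0) := by
    simpa only [zero_smul] using
      (tendsto_one_div_add_atTop_nhds_zero_nat (𝕜 := ℝ)).smul_const u
  have houter : Tendsto (fun n a a' => v n a * v n a') atTop (𝓝 (0 : Fin k → Fin k → ℝ)) := by
    have hcont : Continuous fun (x : EuclideanSpace ℝ (Fin k)) (a a' : Fin k) => x a * x a' := by
      fun_prop
    have hzero : (fun a a' => (0 : EuclideanSpace ℝ (Fin k)) a * (0 : EuclideanSpace ℝ (Fin k)) a')
        = (0 : Fin k → Fin k → ℝ) := by
      funext a a'
      exact zero_mul _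
    exact hzero ▸ (hcont.tendsto 0).comp hv
  choose s hs using fun n => b.exists_half_le_integral_test_field (hv_ne n)
  exact ⟨b.toJetProbe, fun n => b.field (s n) (v n), fun n => b.kernel (s n) _,
    fun n => b.isGaussianField_field _ _, fun n => b.covarianceFun_field _ _,
    b.tendsto_kernel s houter, hs⟩

/-! ### Separation from the zero field -/

section Zero

variable {m : ℕ} {H : Type*} [TopologicalSpace H]
  {I : ModelWithCorners ℝ (EuclideanSpace ℝ (Fin m)) H}
  {M : Type*} [TopologicalSpace M] [ChartedSpace H M] {k r : ℕ}
  {Ω : Type*} [MeasurableSpace Ω] {P : Measure Ω}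

variable (P) in
theorem covarianceFun_zero :
    covarianceFun P (fun _ => (0 : CrMap I M k r)) = (0 : CrrMap I M k r).1 := by
  funext z a b
  exact (integral_congr_ae (Eventually.of_forall fun _ => zero_mul _)).trans (integral_zero _ _)

variable [IsProbabilityMeasure P]

variable (P) in
theorem isGaussianField_zero : IsGaussianField P fun _ => (0 : CrMap I M k r) where
  measurable := measurable_const
  gaussian j p := by
    rw [Measure.map_const, measure_univ, one_smul]
    infer_instance
  centered _ := integral_zero _ _

theorem IsGaussianField.exists_covarianceOf_eq [IsManifold I ∞ M] {X : Ω → CrMap I M k r}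
    (hX : IsGaussianField P X) :
    ∃ μ : GaussianMeasure I M k r, covarianceOf μ = covarianceFun P X :=
  ⟨⟨⟨P.map X, Measure.isProbabilityMeasure_map hX.measurable.aemeasurable⟩, hX.id_map⟩,
    hX.covarianceFun_id_map⟩

namespace JetProbe

variable (J : JetProbe I M r) {c : ℝ}

theorem not_tendsto_of_le_integral_test (hc : 0 < c) {μ : ℕ → ProbabilityMeasure (CrMap I M k r)}
    {ν : ProbabilityMeasure (CrMap I M k r)}
    (hμ : ∀ n, c ≤ ∫ f, J.test f ∂(μ n : Measure (CrMap I M k r)))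
    (hν : ∫ f, J.test f ∂(ν : Measure (CrMap I M k r)) = 0) : ¬ Tendsto μ atTop (𝓝 ν) := by
  intro h
  let F : BoundedContinuousFunction (CrMap I M k r) ℝ :=
    BoundedContinuousFunction.ofNormedAddCommGroup J.test J.continuous_test 1 fun f =>
      (Real.norm_of_nonneg (J.test_nonneg f)).trans_le (J.test_le_one f)
  have hlim := ProbabilityMeasure.tendsto_iff_forall_integral_tendsto.1 h F
  exact hc.not_ge (hν ▸ ge_of_tendsto' hlim hμ)

variable {X : ℕ → Ω → CrMap I M k r}

theorem not_tendstoInDistribution_zero (hc : 0 < c) (hX : ∀ n, IsGaussianField P (X n))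
    (htest : ∀ n, c ≤ ∫ w, J.test (X n w) ∂P) :
    ¬ TendstoInDistribution X atTop (fun _ => (0 : CrMap I M k r)) (fun _ => P) P := by
  intro h
  have hmap {Y : Ω → CrMap I M k r} (hY : Measurable Y) :
      ∫ f, J.test f ∂P.map Y = ∫ w, J.test (Y w) ∂P :=
    integral_map hY.aemeasurable J.continuous_test.aestronglyMeasurable
  refine J.not_tendsto_of_le_integral_test hc (fun n => ?_) ?_ h.tendsto
  · exact (htest n).trans_eq (hmap (hX n).measurable).symm
  · refine (hmap measurable_const).trans ?_
    simp only [J.test_zero, integral_zero]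

theorem not_continuous_of_covarianceOf_eq [IsManifold I ∞ M] (hc : 0 < c)
    {K : ℕ → CrrMap I M k r} (hX : ∀ n, IsGaussianField P (X n))
    (hcov : ∀ n, covarianceFun P (X n) = (K n).1) (hK : Tendsto K atTop (𝓝 0))
    (htest : ∀ n, c ≤ ∫ w, J.test (X n w) ∂P)
    {inv : CovarianceImage I M k r → GaussianMeasure I M k r}
    (hinv : ∀ L : CovarianceImage I M k r, covarianceOf (inv L) = L.1.1) : ¬ Continuous inv := by
  intro hcont
  have hinteg {Y : Ω → CrMap I M k r} (hY : IsGaussianField P Y) (L : CovarianceImage I M k r)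
      (hL : covarianceFun P Y = L.1.1) :
      ∫ f, J.test f ∂((inv L).1 : Measure (CrMap I M k r)) = ∫ w, J.test (Y w) ∂P :=
    J.integral_test_eq_of_covarianceFun_eq (inv L).2 hY ((hinv L).trans hL.symm)
  let L (n : ℕ) : CovarianceImage I M k r := ⟨K n, hcov n ▸ (hX n).exists_covarianceOf_eq⟩
  have hzero : IsGaussianField P fun _ => (0 : CrMap I M k r) := isGaussianField_zero P
  have hcov₀ : covarianceFun P (fun _ => (0 : CrMap I M k r)) = (0 : CrrMap I M k r).1 :=
    covarianceFun_zero P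
  let L₀ : CovarianceImage I M k r := ⟨0, hcov₀ ▸ hzero.exists_covarianceOf_eq⟩
  have hL : Tendsto L atTop (𝓝 L₀) := tendsto_subtype_rng.2 hK
  refine J.not_tendsto_of_le_integral_test hc (fun n => ?_) ?_
    ((continuous_subtype_val.comp hcont).continuousAt.tendsto.comp hL)
  · exact (htest n).trans_eq (hinteg (hX n) (L n) (hcov n)).symm
  · refine (hinteg hzero L₀ hcov₀).trans ?_
    simp only [J.test_zero, integral_zero]

end JetProbe

end Zero

end GRF

theorem mainTheorem6_general {m k : ℕ} (hm : 0 < m) (hk : 0 < k) (r : ℕ)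
    {H : Type*} [TopologicalSpace H]
    (I : ModelWithCorners ℝ (EuclideanSpace ℝ (Fin m)) H)
    (M : Type*) [TopologicalSpace M] [ChartedSpace H M] [IsManifold I ∞ M]
    [T2Space M] [Nonempty M] :
    (∀ inv : GRF.CovarianceImage I M k r → GRF.GaussianMeasure I M k r,
      (∀ K : GRF.CovarianceImage I M k r, GRF.covarianceOf (inv K) = K.1.1) →
        ¬ Continuous inv) ∧
    (∃ (Ω : Type) (_ : MeasurableSpace Ω) (P : Measure Ω) (_ : IsProbabilityMeasure P)
      (X : ℕ → Ω → GRF.CrMap I M k r) (K : ℕ → GRF.CrrMap I M k r),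
      (∀ n, GRF.IsGaussianField P (X n)) ∧
      (∀ n, GRF.covarianceFun P (X n) = (K n).1) ∧
      Tendsto K atTop (𝓝 0) ∧
      ¬ TendstoInDistribution X atTop (fun _ => (0 : GRF.CrMap I M k r)) (fun _ => P) P) := by
  obtain ⟨J, X, K, hX, hcov, hK, htest⟩ :=
    GRF.exists_seq_isGaussianField_tendsto_zero hm hk r I M
  exact ⟨fun inv hinv => J.not_continuous_of_covarianceOf_eq one_half_pos hX hcov hK htest hinv,
    ℕ → ℝ, inferInstance, GRF.whiteNoise, inferInstance, X, K, hX, hcov, hK,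
    J.not_tendstoInDistribution_zero one_half_pos hX htest⟩

theorem mainTheorem6 {m k : ℕ} (hm : 0 < m) (hk : 0 < k) (r : ℕ)
    {H : Type*} [TopologicalSpace H]
    (I : ModelWithCorners ℝ (EuclideanSpace ℝ (Fin m)) H)
    (M : Type*) [TopologicalSpace M] [ChartedSpace H M] [IsManifold I ∞ M]
    [T2Space M] [SecondCountableTopology M] [Nonempty M] :
    (∀ inv : GRF.CovarianceImage I M k r → GRF.GaussianMeasure I M k r,
      (∀ K : GRF.CovarianceImage I M k r, GRF.covarianceOf (inv K) = K.1.1) →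
        ¬ Continuous inv) ∧
    (∃ (Ω : Type) (_ : MeasurableSpace Ω) (P : Measure Ω) (_ : IsProbabilityMeasure P)
      (X : ℕ → Ω → GRF.CrMap I M k r) (K : ℕ → GRF.CrrMap I M k r),
      (∀ n, GRF.IsGaussianField P (X n)) ∧
      (∀ n, GRF.covarianceFun P (X n) = (K n).1) ∧
      Tendsto K atTop (𝓝 0) ∧
      ¬ TendstoInDistribution X atTop (fun _ => (0 : GRF.CrMap I M k r)) (fun _ => P) P) :=
  mainTheorem6_general hm hk r I M
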